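/- Let $\mathbb F$ be a field and let $\mathcal P$ be the category of finitely encoded $1$-parameter persistence modules: the functors $M$ from the poset $\mathbb R$ to $\mathbb F$-vector spaces that are isomorphic to $e^*M'$ for some monotone map $e\colon\mathbb R\to P$ to a finite poset $P$ and some pointwise finite-dimensional functor $M'$ on $P$. It is a full abelian subcategory of the category of functors from $\mathbb R$ to vector spaces. Every $M\in\mathcal P$ is isomorphic to a finite direct sum $\bigoplus_{i=1}^n \mathbb I\langle b_i,b_i+\ell_i\rangle$ of interval modules, uniquely up to order, where the nonempty intervals may be open or closed, bounded or unbounded at either end, $b_i\in[-\infty,\infty)$ is the left endpoint (birth) and $\ell_i\in[0,\infty]$ the length. An amplitude on an abelian category $\mathcal A$ is a function $\alpha\colon \mathrm{ob}\,\mathcal A\to[0,\infty]$ with $\alpha(0)=0$ such that for every short exact sequence $0\to A\to B\to C\to 0$ one has $\alpha(A)\le\alpha(B)$, $\alpha(C)\le\alpha(B)$ and $\alpha(B)\le\alpha(A)+\alpha(C)$. (i) For every integer $k\ge 0$, the function that sends $M$ to the sum of the lengths of its $k$ longest intervals (of all its intervals, if there are fewer than $k$) is an amplitude on $\mathcal P$.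 (ii) For all integers $m\ge 0$ and $l\ge 1$, the tropical coordinate $\sigma_{(1,0)^l}(\min\{b_1,m\ell_1\},\ell_1,\dots,\min\{b_n,m\ell_n\},\ell_n)$, that is, the sum of the $l$ largest of the numbers $\min\{b_i,m\ell_i\}$ (of all of them, if $n<l$), is not an amplitude on $\mathcal P$. If moreover $m\ge 1$, it is not an amplitude even on the full abelian subcategory of those $M\in\mathcal P$ with $M(t)=0$ for all $t<0$ (all births are $\ge 0$), where it takes values in $[0,\infty]$. -/

import Mathlib

open CategoryTheory CategoryTheory.Limits
open scoped ENNReal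

universe u v w

noncomputable section

namespace PersMod

/-! ### Persistence modules over the real line and finite encodings -/

/-- One-parameter persistence modules over `F`, as functors on the poset `ℝ`. (Pointwise
finite-dimensionality is part of being finitely encoded, see `FinitelyEncoded`.) -/
abbrev PersistenceModule (F : Type u) [Field F] := ℝ ⥤ ModuleCat.{u} F

/-- A persistence module is finitely encoded if it is isomorphic to the pullback, along a monotone
map `e` from `ℝ` to a finite poset `P`, of a pointwise finite-dimensional module over `P`. -/
def FinitelyEncoded (F : Type u) [Field F] : ObjectProperty (PersistenceModule F) := fun M =>
  ∃ (P : Type) (_ : PartialOrder P) (_ : Finite P) (e : ℝ →o P) (N : P ⥤ ModuleCat.{u} F),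
    (∀ p : P, FiniteDimensional F (N.obj p)) ∧ Nonempty (M ≅ e.monotone.functor ⋙ N)

/-- The finitely encoded modules that vanish at all negative parameters, that is, those all of
whose intervals have birth time at least `0`. -/
def FinitelyEncodedNonneg (F : Type u) [Field F] : ObjectProperty (PersistenceModule F) := fun M =>
  FinitelyEncoded F M ∧ ∀ t : ℝ, t < 0 → IsZero (M.obj t)

/-! ### Amplitudes -/

/-- `α` is an amplitude on the full subcategory of `C` with objects `P` (a full abelian
subcategory, so that its short exact sequences are those of `C` with all three terms in `P`):
its values on this subcategory lie in `[0, ∞]`, it is zero on zero objects, and it is monotone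
and subadditive on short exact sequences. -/
structure IsAmplitude {C : Type w} [Category.{v} C] [Abelian C] (P : ObjectProperty C)
    (α : C → EReal) : Prop where
  nonneg : ∀ M : C, P M → 0 ≤ α M
  zero : ∀ Z : C, P Z → IsZero Z → α Z = 0
  mono_left : ∀ S : ShortComplex C, S.ShortExact → P S.X₁ → P S.X₂ → P S.X₃ → α S.X₁ ≤ α S.X₂
  mono_right : ∀ S : ShortComplex C, S.ShortExact → P S.X₁ → P S.X₂ → P S.X₃ → α S.X₃ ≤ α S.X₂
  subadd : ∀ S : ShortComplex C, S.ShortExact → P S.X₁ → P S.X₂ → P S.X₃ →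
    α S.X₂ ≤ α S.X₁ + α S.X₃

/-! ### Intervals, interval modules, barcodes -/

/-- A nonempty interval of `ℝ`: bounded or unbounded, open or closed at either end. -/
structure Bar where
  carrier : Set ℝ
  ordConnected : carrier.OrdConnected
  nonempty : carrier.Nonempty

/-- The left endpoint (birth time), possibly `-∞`. -/
def Bar.birth (I : Bar) : EReal := sInf ((fun t : ℝ => (t : EReal)) '' I.carrier)

/-- The right endpoint (death time), possibly `+∞`. -/
def Bar.death (I : Bar) : EReal := sSup ((fun t : ℝ => (t : EReal)) '' I.carrier)

/-- The length of an interval, possibly `∞`. -/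
def Bar.length (I : Bar) : ℝ≥0∞ := (I.death - I.birth).toENNReal

/-- The space of the interval module of `I` at `t`: it is `F` if `t ∈ I` and `0` otherwise. -/
def intervalSpace (F : Type u) [Field F] (I : Bar) (t : ℝ) : Submodule F F where
  carrier := {x | t ∈ I.carrier ∨ x = 0}
  add_mem' := by
    rintro x y (hx | hx) (hy | hy)
    · exact Or.inl hx
    · exact Or.inl hx
    · exact Or.inl hy
    · right; rw [hx, hy, add_zero]
  zero_mem' := Or.inr rfl
  smul_mem' := by
    rintro c x (hx | hx)
    · exact Or.inl hx
    · right; rw [hx, smul_zero]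

open Classical in
/-- The structure maps of the interval module: the identity of `F` inside `I`, and `0` otherwise. -/
def intervalMap (F : Type u) [Field F] (I : Bar) (s t : ℝ) :
    intervalSpace F I s →ₗ[F] intervalSpace F I t where
  toFun x := ⟨if t ∈ I.carrier then (x : F) else 0, by
    by_cases h : t ∈ I.carrier
    · exact Or.inl h
    · right; simp [h]⟩
  map_add' x y := by
    ext; by_cases h : t ∈ I.carrier <;> simp [h]
  map_smul' c x := by
    ext; by_cases h : t ∈ I.carrier <;> simp [h]

/-- The interval module of `I`. -/
def intervalModule (F : Type u) [Field F] (I : Bar) : PersistenceModule F where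
  obj t := ModuleCat.of F (intervalSpace F I t)
  map {s t} _ := ModuleCat.ofHom (intervalMap F I s t)
  map_id t := by
    ext x
    rcases x with ⟨x, hx | hx⟩
    · simp [intervalMap, hx]
    · simp [intervalMap, hx]
  map_comp {r s t} f g := by
    ext x
    rcases x with ⟨x, hx | hx⟩
    · by_cases ht : t ∈ I.carrier
      · have hs : s ∈ I.carrier := I.ordConnected.out hx ht ⟨leOfHom f, leOfHom g⟩
        simp [intervalMap, ht, hs]
      · simp [intervalMap, ht]
    · simp [intervalMap, hx]

instance hasFiniteBiproducts_persistenceModule (F : Type u) [Field F] :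
    HasFiniteBiproducts (PersistenceModule F) :=
  Abelian.hasFiniteBiproducts

/-- The finite multiset `B` of intervals is a barcode of `M`: `M` is isomorphic to the direct sum
of the corresponding interval modules. -/
def IsBarcode {F : Type u} [Field F] (M : PersistenceModule F) (B : Multiset Bar) : Prop :=
  ∃ (n : ℕ) (I : Fin n → Bar), B = Finset.univ.val.map I ∧
    Nonempty (M ≅ ⨁ fun i => intervalModule F (I i))

open Classical in
/-- The barcode of `M` (a finitely encoded module has exactly one). -/
def barcode {F : Type u} [Field F] (M : PersistenceModule F) : Multiset Bar :=
  if h : ∃ B, IsBarcode M B then h.choose else 0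

/-! ### The tropical coordinates -/

/-- The sum of the `k` largest elements of `s` (of all elements, if there are fewer than `k`). -/
def topSum {R : Type*} [LinearOrder R] [AddCommMonoid R] (k : ℕ) (s : Multiset R) : R :=
  ((s.sort (fun a b => b ≤ a)).take k).sum

/-- The sum of the lengths of the `k` longest intervals of `M`. -/
def tropLen {F : Type u} [Field F] (k : ℕ) (M : PersistenceModule F) : ℝ≥0∞ :=
  topSum k ((barcode M).map Bar.length)

/-- The tropical coordinate `σ_{(1,0)^l}(min{b_i, m ℓ_i}, ℓ_i)`: the sum of the `l` largest
expressions `min{b_i, m ℓ_i}`, where `b_i` is the birth time and `ℓ_i` the length of the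
`i`-th interval of `M`. -/
def tropBirth {F : Type u} [Field F] (m l : ℕ) (M : PersistenceModule F) : EReal :=
  topSum l ((barcode M).map fun I => min I.birth ((m : EReal) * (I.length : EReal)))

end PersMod

end

/-! For a finite direct sum of interval modules, the rank of M(s) → M(t) is the number of bars
containing s and t. Along an injection A → B, the space im A(s → t) ∩ ker A(t → u) embeds into its
counterpart for B, so A has at most as many bars as B that contain s and t but not u
(`rank_add_rank_le_of_injective`, `card_le_of_injective`). For a surjection the same holds with a
parameter u before s. Sorting bars by their last (or first) point in a suitable finite set turns
this into an inequality between the numbers of bars of span ε, for every ε ≥ 0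
(`card_hasSpan_le_of_injective`, `card_hasSpan_le_of_surjective`). Such counts control the sorted
lengths term by term (`topSum_length_le`), which gives both monotonicity axioms in (i).

For subadditivity on 0 → A → B → C → 0, let D ⊆ B be the sum of the k longest bars, and let K and E
be the kernel and the image of D → C. As a submodule and a quotient of D, both have at most k bars
of positive length, so their total lengths are bounded by their `tropLen k`, and hence by those of A
and C, into which they embed. Total length is the integral of the pointwise dimension
(`DecomposesAs.sum_length_eq`), so it is additive: the length of D is that of K plus that of E.

Barcodes exist because a nonzero module that is constant on the fibers of an encoding splits off an
interval module, and the dimension drops (`ConstantOnFibers.exists_summand`). Full uniqueness is not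
needed: comparing two decompositions along the identity shows that `tropLen` depends on neither.

In (ii), the interval module of [-1, 0) has a negative value. With births ≥ 0, the submodule [1, 2)
of [0, 2) has value min(1, m) = 1, while [0, 2) has value 0. Only the barcodes of interval modules
enter (`barcode_intervalModule`). -/

noncomputable section

namespace PersMod

variable {F : Type u} [Field F]

/-! ### Decompositions into interval modules -/

/-- The structure map of a persistence module as a linear map. -/
abbrev structureMap (M : PersistenceModule F) {s t : ℝ} (h : s ≤ t) : M.obj s →ₗ[F] M.obj t :=
  (M.map (homOfLE h)).hom

lemma structureMap_self (M : PersistenceModule F) {s : ℝ} (h : s ≤ s) :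
    structureMap M h = LinearMap.id := by
  simp [structureMap]

lemma structureMap_comp_apply (M : PersistenceModule F) {r s t : ℝ} (h : r ≤ s) (h' : s ≤ t)
    (x : M.obj r) :
    structureMap M h' (structureMap M h x) = structureMap M (h.trans h') x := by
  exact congrArg (fun g => g.hom x) (M.map_comp (homOfLE h) (homOfLE h')).symm

lemma app_structureMap {M N : PersistenceModule F} (f : M ⟶ N) {s t : ℝ} (h : s ≤ t)
    (x : M.obj s) :
    (f.app t).hom (structureMap M h x) = structureMap N h ((f.app s).hom x) := by
  exact congrArg (fun g => g.hom x) (f.naturality (homOfLE h))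

/-- The inclusion of the space of an interval module into the ground field. -/
def intervalCoord (I : Bar) (t : ℝ) : (intervalModule F I).obj t →ₗ[F] F :=
  (intervalSpace F I t).subtype

lemma intervalCoord_injective (I : Bar) (t : ℝ) :
    Function.Injective (intervalCoord (F := F) I t) :=
  Subtype.val_injective

lemma intervalCoord_eq_zero {I : Bar} {t : ℝ} (ht : t ∉ I.carrier)
    (x : (intervalModule F I).obj t) : intervalCoord I t x = 0 :=
  x.2.resolve_left ht

lemma exists_intervalCoord_eq {I : Bar} {t : ℝ} {c : F} (h : t ∉ I.carrier → c = 0) :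
    ∃ x : (intervalModule F I).obj t, intervalCoord I t x = c :=
  ⟨⟨c, or_iff_not_imp_left.2 h⟩, rfl⟩

lemma intervalCoord_structureMap {I : Bar} {s t : ℝ} (h : s ≤ t) (ht : t ∈ I.carrier)
    (x : (intervalModule F I).obj s) :
    intervalCoord I t (structureMap (intervalModule F I) h x) = intervalCoord I s x :=
  if_pos ht

/-- `M` is the direct sum of the interval modules of the bars `I i`. -/
def DecomposesAs {ι : Type} [Fintype ι] (M : PersistenceModule F) (I : ι → Bar) : Prop :=
  ∃ (a : ∀ i, intervalModule F (I i) ⟶ M) (p : ∀ i, M ⟶ intervalModule F (I i)),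
    (∀ i, a i ≫ p i = 𝟙 _) ∧ (∀ i j, i ≠ j → a i ≫ p j = 0) ∧ ∑ i, p i ≫ a i = 𝟙 M

lemma decomposesAs_of_iso {ι : Type} [Fintype ι] {M : PersistenceModule F} {I : ι → Bar}
    (e : M ≅ ⨁ fun i => intervalModule F (I i)) : DecomposesAs M I := by
  classical
  refine ⟨fun i => biproduct.ι (fun i => intervalModule F (I i)) i ≫ e.inv,
    fun i => e.hom ≫ biproduct.π (fun i => intervalModule F (I i)) i, fun i => ?_,
    fun i j h => ?_, ?_⟩
  · simp
  · simp [biproduct.ι_π_ne _ h]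
  · have h := congrArg (fun f => e.hom ≫ f ≫ e.inv)
      (biproduct.total (f := fun i => intervalModule F (I i)))
    simp only [Preadditive.comp_sum, Preadditive.sum_comp, Category.id_comp, Iso.hom_inv_id]
      at h
    simpa only [Category.assoc] using h

lemma DecomposesAs.nonempty_iso {ι : Type} [Fintype ι] {M : PersistenceModule F} {I : ι → Bar}
    (h : DecomposesAs M I) : Nonempty (M ≅ ⨁ fun i => intervalModule F (I i)) := by
  classical
  obtain ⟨a, p, h1, h2, h3⟩ := h
  refine ⟨⟨biproduct.lift p, biproduct.desc a, ?_, ?_⟩⟩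
  · rw [biproduct.lift_desc, h3]
  · refine biproduct.hom_ext' _ _ fun i => biproduct.hom_ext _ _ fun j => ?_
    by_cases hij : i = j
    · subst hij; simp [h1]
    · simp [h2 i j hij, biproduct.ι_π_ne _ hij]

lemma decomposesAs_intervalModule (I : Bar) :
    DecomposesAs (intervalModule F I) (fun _ : Unit => I) :=
  ⟨fun _ => 𝟙 _, fun _ => 𝟙 _, by simp, by simp, by simp⟩

lemma DecomposesAs.reindex {ι κ : Type} [Fintype ι] [Fintype κ] {M : PersistenceModule F}
    {I : ι → Bar} (h : DecomposesAs M I) (e : κ ≃ ι) : DecomposesAs M (I ∘ e) := by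
  obtain ⟨a, p, h1, h2, h3⟩ := h
  refine ⟨fun k => a (e k), fun k => p (e k), fun k => h1 _, fun k k' hk => h2 _ _ ?_, ?_⟩
  · exact fun h => hk (e.injective h)
  · rw [← h3]
    exact Equiv.sum_comp e fun i => p i ≫ a i

/-- Coordinates with respect to a decomposition into interval modules. -/
lemma DecomposesAs.exists_coords {ι : Type} [Fintype ι] {M : PersistenceModule F} {I : ι → Bar}
    (h : DecomposesAs M I) : ∃ c : ∀ t : ℝ, M.obj t →ₗ[F] (ι → F),
      (∀ t, Function.Injective (c t)) ∧
      (∀ t (y : ι → F), (∀ i, t ∉ (I i).carrier → y i = 0) → ∃ x, c t x = y) ∧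
      (∀ t x i, t ∉ (I i).carrier → c t x i = 0) ∧
      (∀ s t (hst : s ≤ t) x i, t ∈ (I i).carrier → c t (structureMap M hst x) i = c s x i) := by
  classical
  obtain ⟨a, p, h1, h2, h3⟩ := h
  have tot : ∀ t (x : M.obj t), ∑ i, ((a i).app t).hom (((p i).app t).hom x) = x := by
    intro t x
    have := congrArg (fun f => (f.app t).hom x) h3
    simpa [NatTrans.app_sum] using this
  have e1 : ∀ t i (x : (intervalModule F (I i)).obj t),
      ((p i).app t).hom (((a i).app t).hom x) = x := by
    intro t i x
    exact congrArg (fun f => (f.app t).hom x) (h1 i)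
  have e2 : ∀ t i j (x : (intervalModule F (I i)).obj t), i ≠ j →
      ((p j).app t).hom (((a i).app t).hom x) = 0 := by
    intro t i j x hij
    exact congrArg (fun f => (f.app t).hom x) (h2 i j hij)
  refine ⟨fun t => LinearMap.pi fun i => intervalCoord (I i) t ∘ₗ ((p i).app t).hom,
    ?_, ?_, ?_, ?_⟩
  · intro t x y hxy
    rw [← tot t x, ← tot t y]
    refine Finset.sum_congr rfl fun i _ => ?_
    congr 1
    exact intervalCoord_injective (I i) t (congrFun hxy i)
  · intro t y hy
    choose z hz using fun i => exists_intervalCoord_eq (hy i)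
    refine ⟨∑ i, ((a i).app t).hom (z i), ?_⟩
    funext j
    rw [LinearMap.pi_apply, LinearMap.comp_apply, map_sum, Finset.sum_eq_single j, e1, hz]
    · intro i _ hij
      exact e2 t i j _ hij
    · simp
  · intro t x i ht
    exact intervalCoord_eq_zero ht _
  · intro s t hst x i ht
    rw [LinearMap.pi_apply, LinearMap.comp_apply, app_structureMap (p i) hst x,
      intervalCoord_structureMap hst ht]
    rfl

lemma finrank_of_forall_mem_iff {ι : Type} [Fintype ι] (p : ι → Prop) [DecidablePred p]
    (W : Submodule F (ι → F)) (hW : ∀ y, y ∈ W ↔ ∀ i, ¬ p i → y i = 0) :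
    Module.finrank F W = (Finset.univ.filter p).card := by
  classical
  have e : W ≃ₗ[F] ({i // p i} → F) :=
    { toFun := fun y i => (y : ι → F) i
      map_add' := fun _ _ => rfl
      map_smul' := fun _ _ => rfl
      invFun := fun z => ⟨fun i => if h : p i then z ⟨i, h⟩ else 0, (hW _).2 fun i h => by
        simp [h]⟩
      left_inv := fun y => by
        ext i
        by_cases h : p i
        · simp [h]
        · simp [h, (hW y).1 y.2 i h]
      right_inv := fun z => by
        ext ⟨i, h⟩
        simp [h] }
  rw [e.finrank_eq, Module.finrank_fintype_fun_eq_card, Fintype.card_subtype]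

open Classical in
/-- The rank of a structure map counts the bars containing both parameters. -/
lemma DecomposesAs.finrank_range {ι : Type} [Fintype ι] {M : PersistenceModule F} {I : ι → Bar}
    (h : DecomposesAs M I) {s t : ℝ} (hst : s ≤ t) :
    Module.finrank F (LinearMap.range (structureMap M hst)) =
      (Finset.univ.filter fun i => s ∈ (I i).carrier ∧ t ∈ (I i).carrier).card := by
  obtain ⟨c, c1, c2, c3, c4⟩ := h.exists_coords
  rw [(Submodule.equivMapOfInjective (c t) (c1 t) _).finrank_eq]
  refine finrank_of_forall_mem_iff _ _ fun y => ⟨?_, fun hy => ?_⟩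
  · rintro ⟨_, ⟨x, rfl⟩, rfl⟩ i hi
    by_cases ht : t ∈ (I i).carrier
    · rw [c4 s t hst x i ht]
      exact c3 s x i fun hs => hi ⟨hs, ht⟩
    · exact c3 t _ i ht
  · obtain ⟨x, rfl⟩ := c2 s y fun i hi => hy i fun h => hi h.1
    refine ⟨_, ⟨x, rfl⟩, ?_⟩
    funext i
    by_cases ht : t ∈ (I i).carrier
    · exact c4 s t hst x i ht
    · rw [c3 t _ i ht, hy i fun h => ht h.2]

lemma DecomposesAs.finiteDimensional {ι : Type} [Fintype ι] {M : PersistenceModule F}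
    {I : ι → Bar} (h : DecomposesAs M I) (t : ℝ) : FiniteDimensional F (M.obj t) := by
  obtain ⟨c, c1, -⟩ := h.exists_coords
  exact FiniteDimensional.of_injective (c t) (c1 t)

/-! ### Counting bars along injections and surjections -/

/-- Rank-nullity for the restriction of `f` to `U`. With `U` the image of a structure map, it turns
differences of ranks into dimensions of subspaces, which can be compared. -/
lemma finrank_map_add_finrank_inf_ker {V W : Type*} [AddCommGroup V] [Module F V]
    [AddCommGroup W] [Module F W] [FiniteDimensional F V] (f : V →ₗ[F] W) (U : Submodule F V) :
    Module.finrank F (U.map f) + Module.finrank F (U ⊓ LinearMap.ker f : Submodule F V) =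
      Module.finrank F U := by
  have h := LinearMap.finrank_range_add_finrank_ker (f.domRestrict U)
  rw [LinearMap.range_domRestrict, LinearMap.ker_domRestrict] at h
  rw [← h, ← Submodule.map_comap_subtype U (LinearMap.ker f),
    (Submodule.equivMapOfInjective U.subtype U.injective_subtype _).finrank_eq]

lemma map_range_structureMap (M : PersistenceModule F) {s t u : ℝ} (hst : s ≤ t) (htu : t ≤ u) :
    (LinearMap.range (structureMap M hst)).map (structureMap M htu) =
      LinearMap.range (structureMap M (hst.trans htu)) := by
  rw [← LinearMap.range_comp]
  congr 1
  ext x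
  exact structureMap_comp_apply M hst htu x

lemma map_app_range_structureMap_le {M N : PersistenceModule F} (f : M ⟶ N) {s t : ℝ}
    (hst : s ≤ t) : (LinearMap.range (structureMap M hst)).map (f.app t).hom ≤
      LinearMap.range (structureMap N hst) := by
  rintro _ ⟨_, ⟨x, rfl⟩, rfl⟩
  exact ⟨_, (app_structureMap f hst x).symm⟩

lemma map_app_range_structureMap_eq {M N : PersistenceModule F} (f : M ⟶ N) {s t : ℝ}
    (hf : Function.Surjective (f.app s).hom) (hst : s ≤ t) :
    (LinearMap.range (structureMap M hst)).map (f.app t).hom =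
      LinearMap.range (structureMap N hst) := by
  refine le_antisymm (map_app_range_structureMap_le f hst) ?_
  rintro _ ⟨y, rfl⟩
  obtain ⟨x, rfl⟩ := hf y
  exact ⟨_, ⟨x, rfl⟩, app_structureMap f hst x⟩

/-- The rank of a structure map. -/
def rank (M : PersistenceModule F) {s t : ℝ} (hst : s ≤ t) : ℕ :=
  Module.finrank F (LinearMap.range (structureMap M hst))

lemma rank_le_of_injective {A B : PersistenceModule F} (f : A ⟶ B)
    (hf : ∀ t, Function.Injective (f.app t).hom) (hB : ∀ t, FiniteDimensional F (B.obj t))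
    {s t : ℝ} (hst : s ≤ t) : rank A hst ≤ rank B hst := by
  have := hB t
  have h := Submodule.finrank_mono (map_app_range_structureMap_le f hst)
  rwa [← (Submodule.equivMapOfInjective _ (hf t) _).finrank_eq] at h

/-- The drop in rank from (s, t) to (s, u) is the dimension of the vectors at t that come from s and
die by u. A monomorphism embeds these vectors of `A` into those of `B`. -/
lemma rank_add_rank_le_of_injective {A B : PersistenceModule F} (f : A ⟶ B)
    (hf : ∀ t, Function.Injective (f.app t).hom) (hA : ∀ t, FiniteDimensional F (A.obj t))
    (hB : ∀ t, FiniteDimensional F (B.obj t)) {s t u : ℝ} (hst : s ≤ t) (htu : t ≤ u) :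
    rank A hst + rank B (hst.trans htu) ≤ rank A (hst.trans htu) + rank B hst := by
  have := hA t
  have := hB t
  have h1 := finrank_map_add_finrank_inf_ker (structureMap A htu)
    (LinearMap.range (structureMap A hst))
  have h2 := finrank_map_add_finrank_inf_ker (structureMap B htu)
    (LinearMap.range (structureMap B hst))
  rw [map_range_structureMap] at h1 h2
  have h3 : (LinearMap.range (structureMap A hst) ⊓ LinearMap.ker (structureMap A htu)).map
      (f.app t).hom ≤
      LinearMap.range (structureMap B hst) ⊓ LinearMap.ker (structureMap B htu) := by
    refine le_inf ((Submodule.map_mono inf_le_left).trans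
      (map_app_range_structureMap_le f hst)) ?_
    rintro _ ⟨x, hx, rfl⟩
    rw [LinearMap.mem_ker, ← app_structureMap, LinearMap.mem_ker.1 hx.2, map_zero]
  have h4 := Submodule.finrank_mono h3
  rw [← (Submodule.equivMapOfInjective _ (hf t) _).finrank_eq] at h4
  simp only [rank]
  omega

lemma rank_le_of_surjective {B C : PersistenceModule F} (g : B ⟶ C)
    (hg : ∀ t, Function.Surjective (g.app t).hom) (hB : ∀ t, FiniteDimensional F (B.obj t))
    {s t : ℝ} (hst : s ≤ t) : rank C hst ≤ rank B hst := by
  have := hB t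
  simp only [rank]
  rw [← map_app_range_structureMap_eq g (hg s) hst]
  exact Submodule.finrank_map_le _ _

/-- The excess of the rank of `B` over that of `C` is the dimension of the part of ker g at t that
lies in the image from the source parameter. This image grows when the source moves from u to s. -/
lemma rank_add_rank_le_of_surjective {B C : PersistenceModule F} (g : B ⟶ C)
    (hg : ∀ t, Function.Surjective (g.app t).hom) (hB : ∀ t, FiniteDimensional F (B.obj t))
    {u s t : ℝ} (hus : u ≤ s) (hst : s ≤ t) :
    rank C hst + rank B (hus.trans hst) ≤ rank C (hus.trans hst) + rank B hst := by
  have := hB t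
  have h1 := finrank_map_add_finrank_inf_ker (g.app t).hom
    (LinearMap.range (structureMap B hst))
  have h2 := finrank_map_add_finrank_inf_ker (g.app t).hom
    (LinearMap.range (structureMap B (hus.trans hst)))
  rw [map_app_range_structureMap_eq g (hg _)] at h1 h2
  have h3 : LinearMap.range (structureMap B (hus.trans hst)) ⊓ LinearMap.ker (g.app t).hom ≤
      LinearMap.range (structureMap B hst) ⊓ LinearMap.ker (g.app t).hom := by
    refine inf_le_inf_right _ ?_
    rintro _ ⟨x, rfl⟩
    exact ⟨_, structureMap_comp_apply B hus hst x⟩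
  have h4 := Submodule.finrank_mono h3
  simp only [rank]
  omega

open Classical in
lemma DecomposesAs.rank_eq {ι : Type} [Fintype ι] {M : PersistenceModule F} {I : ι → Bar}
    (h : DecomposesAs M I) {s t : ℝ} (hst : s ≤ t) :
    rank M hst = (Finset.univ.filter fun i => s ∈ (I i).carrier ∧ t ∈ (I i).carrier).card :=
  h.finrank_range hst

/-- If `P` implies `Q` then the elements with `Q` split into those with `P` and the others. -/
lemma card_filter_add_card_filter_not {ι : Type*} [Fintype ι] (P Q : ι → Prop) [DecidablePred P]
    [DecidablePred Q] (h : ∀ i, P i → Q i) :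
    (Finset.univ.filter P).card + (Finset.univ.filter fun i => Q i ∧ ¬ P i).card =
      (Finset.univ.filter Q).card := by
  rw [← Finset.card_filter_add_card_filter_not (s := Finset.univ.filter Q) P,
    Finset.filter_filter, Finset.filter_filter]
  congr 2
  ext i
  simpa using fun hi => h i hi

section Counting

variable {ι κ : Type} [Fintype ι] [Fintype κ]

-- By convexity, a bar through t avoids all later points of `S` as soon as it avoids the next one,
-- u. Both counts are therefore rank differences between (s, t) and (s, u), or plain ranks if no
-- such u exists.
open Classical in
lemma card_le_of_injective {A B : PersistenceModule F} {I : ι → Bar} {J : κ → Bar}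
    (hA : DecomposesAs A I) (hB : DecomposesAs B J) (f : A ⟶ B)
    (hf : ∀ t, Function.Injective (f.app t).hom) (S : Finset ℝ) {s t : ℝ} (hst : s ≤ t) :
    (Finset.univ.filter fun i => (s ∈ (I i).carrier ∧ t ∈ (I i).carrier) ∧
      ∀ u ∈ S, t < u → u ∉ (I i).carrier).card ≤
    (Finset.univ.filter fun j => (s ∈ (J j).carrier ∧ t ∈ (J j).carrier) ∧
      ∀ u ∈ S, t < u → u ∉ (J j).carrier).card := by
  rcases (S.filter (t < ·)).eq_empty_or_nonempty with h | h
  · have key : ∀ K : Bar, ((s ∈ K.carrier ∧ t ∈ K.carrier) ∧ ∀ u ∈ S, t < u → u ∉ K.carrier) ↔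
        (s ∈ K.carrier ∧ t ∈ K.carrier) := fun K =>
      and_iff_left fun u hu htu =>
        absurd (Finset.mem_filter.2 ⟨hu, htu⟩) (h ▸ Finset.notMem_empty u)
    simp only [key]
    rw [← hA.rank_eq hst, ← hB.rank_eq hst]
    exact rank_le_of_injective f hf hB.finiteDimensional hst
  · set u := (S.filter (t < ·)).min' h with hu
    obtain ⟨huS, htu⟩ := Finset.mem_filter.1 (Finset.min'_mem _ h)
    rw [← hu] at huS htu
    have key : ∀ K : Bar, ((s ∈ K.carrier ∧ t ∈ K.carrier) ∧ ∀ u ∈ S, t < u → u ∉ K.carrier) ↔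
        (s ∈ K.carrier ∧ t ∈ K.carrier) ∧ ¬ (s ∈ K.carrier ∧ u ∈ K.carrier) := fun K => by
      refine and_congr_right fun hK => ⟨fun H hu' => H u huS htu hu'.2, fun H v hv htv hvK => ?_⟩
      exact H ⟨hK.1, K.ordConnected.out hK.2 hvK
        ⟨htu.le, Finset.min'_le _ _ (Finset.mem_filter.2 ⟨hv, htv⟩)⟩⟩
    have sub : ∀ K : Bar, s ∈ K.carrier ∧ u ∈ K.carrier → s ∈ K.carrier ∧ t ∈ K.carrier :=
      fun K hK => ⟨hK.1, K.ordConnected.out hK.1 hK.2 ⟨hst, htu.le⟩⟩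
    simp only [key]
    have h1 := card_filter_add_card_filter_not _ _ fun i => sub (I i)
    have h2 := card_filter_add_card_filter_not _ _ fun j => sub (J j)
    have h3 := rank_add_rank_le_of_injective f hf hA.finiteDimensional hB.finiteDimensional
      hst htu.le
    rw [hA.rank_eq, hB.rank_eq, hA.rank_eq, hB.rank_eq] at h3
    omega

-- Mirror image of the injective case: only the last point of `S` before s matters.
open Classical in
lemma card_le_of_surjective {B C : PersistenceModule F} {I : ι → Bar} {J : κ → Bar}
    (hC : DecomposesAs C I) (hB : DecomposesAs B J) (g : B ⟶ C)
    (hg : ∀ t, Function.Surjective (g.app t).hom) (S : Finset ℝ) {s t : ℝ} (hst : s ≤ t) :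
    (Finset.univ.filter fun i => (s ∈ (I i).carrier ∧ t ∈ (I i).carrier) ∧
      ∀ u ∈ S, u < s → u ∉ (I i).carrier).card ≤
    (Finset.univ.filter fun j => (s ∈ (J j).carrier ∧ t ∈ (J j).carrier) ∧
      ∀ u ∈ S, u < s → u ∉ (J j).carrier).card := by
  rcases (S.filter (· < s)).eq_empty_or_nonempty with h | h
  · have key : ∀ K : Bar, ((s ∈ K.carrier ∧ t ∈ K.carrier) ∧ ∀ u ∈ S, u < s → u ∉ K.carrier) ↔
        (s ∈ K.carrier ∧ t ∈ K.carrier) := fun K =>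
      and_iff_left fun u hu hus =>
        absurd (Finset.mem_filter.2 ⟨hu, hus⟩) (h ▸ Finset.notMem_empty u)
    simp only [key]
    rw [← hC.rank_eq hst, ← hB.rank_eq hst]
    exact rank_le_of_surjective g hg hB.finiteDimensional hst
  · set u := (S.filter (· < s)).max' h with hu
    obtain ⟨huS, hus⟩ := Finset.mem_filter.1 (Finset.max'_mem _ h)
    rw [← hu] at huS hus
    have key : ∀ K : Bar, ((s ∈ K.carrier ∧ t ∈ K.carrier) ∧ ∀ u ∈ S, u < s → u ∉ K.carrier) ↔
        (s ∈ K.carrier ∧ t ∈ K.carrier) ∧ ¬ (u ∈ K.carrier ∧ t ∈ K.carrier) := fun K => by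
      refine and_congr_right fun hK => ⟨fun H hu' => H u huS hus hu'.1, fun H v hv hvs hvK => ?_⟩
      exact H ⟨K.ordConnected.out hvK hK.1
        ⟨Finset.le_max' _ _ (Finset.mem_filter.2 ⟨hv, hvs⟩), hus.le⟩, hK.2⟩
    have sub : ∀ K : Bar, u ∈ K.carrier ∧ t ∈ K.carrier → s ∈ K.carrier ∧ t ∈ K.carrier :=
      fun K hK => ⟨K.ordConnected.out hK.1 hK.2 ⟨hus.le, hst⟩, hK.2⟩
    simp only [key]
    have h1 := card_filter_add_card_filter_not _ _ fun i => sub (I i)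
    have h2 := card_filter_add_card_filter_not _ _ fun j => sub (J j)
    have h3 := rank_add_rank_le_of_surjective g hg hB.finiteDimensional hus.le hst
    rw [hC.rank_eq, hB.rank_eq, hC.rank_eq, hB.rank_eq] at h3
    omega

/-- A bar contains two parameters at distance `ε`. -/
def Bar.HasSpan (ε : ℝ) (K : Bar) : Prop := ∃ t, t ∈ K.carrier ∧ t + ε ∈ K.carrier

open Classical in
/-- Comparing counts fiberwise over a finite set of parameters, when every `i` with `P i` lies in
some fiber and the fibers of `R'` are disjoint. -/
lemma card_le_of_fibers {α β : Type*} [Fintype α] [Fintype β] (P : α → Prop) (Q : β → Prop)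
    (S : Finset ℝ) (R : α → ℝ → Prop) (R' : β → ℝ → Prop)
    (h1 : ∀ i, P i → ∃ t ∈ S, R i t) (h2 : ∀ j t, t ∈ S → R' j t → Q j)
    (h3 : ∀ j t t', t ∈ S → t' ∈ S → R' j t → R' j t' → t = t')
    (h4 : ∀ t ∈ S, (Finset.univ.filter fun i => R i t).card ≤
      (Finset.univ.filter fun j => R' j t).card) :
    (Finset.univ.filter P).card ≤ (Finset.univ.filter Q).card := by
  calc (Finset.univ.filter P).card
      ≤ (S.biUnion fun t => Finset.univ.filter fun i => R i t).card := by
        refine Finset.card_le_card fun i hi => ?_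
        obtain ⟨t, ht, hR⟩ := h1 i (Finset.mem_filter.1 hi).2
        exact Finset.mem_biUnion.2 ⟨t, ht, Finset.mem_filter.2 ⟨Finset.mem_univ _, hR⟩⟩
    _ ≤ ∑ t ∈ S, (Finset.univ.filter fun i => R i t).card := Finset.card_biUnion_le
    _ ≤ ∑ t ∈ S, (Finset.univ.filter fun j => R' j t).card := Finset.sum_le_sum h4
    _ = (S.biUnion fun t => Finset.univ.filter fun j => R' j t).card := by
        refine (Finset.card_biUnion fun t ht t' ht' hne => ?_).symm
        refine Finset.disjoint_left.2 fun j hj hj' => hne ?_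
        exact h3 j t t' ht ht' (Finset.mem_filter.1 hj).2 (Finset.mem_filter.1 hj').2
    _ ≤ (Finset.univ.filter Q).card := by
        refine Finset.card_le_card fun j hj => ?_
        obtain ⟨t, ht, hR⟩ := Finset.mem_biUnion.1 hj
        exact Finset.mem_filter.2 ⟨Finset.mem_univ _, h2 j t ht (Finset.mem_filter.1 hR).2⟩

open Classical in
/-- A submodule has at most as many bars of span `ε`. -/
lemma card_hasSpan_le_of_injective {A B : PersistenceModule F} {I : ι → Bar} {J : κ → Bar}
    (hA : DecomposesAs A I) (hB : DecomposesAs B J) (f : A ⟶ B)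
    (hf : ∀ t, Function.Injective (f.app t).hom) {ε : ℝ} (hε : 0 ≤ ε) :
    (Finset.univ.filter fun i => (I i).HasSpan ε).card ≤
      (Finset.univ.filter fun j => (J j).HasSpan ε).card := by
  -- Each bar of span ε is marked at the right end of a span, and `S` is the set of marks. A bar is
  -- assigned to the last point of `S` that it contains; moving its mark to the right keeps the
  -- point ε earlier inside the bar.
  have hex : ∀ i, ∃ t, (I i).HasSpan ε → t - ε ∈ (I i).carrier ∧ t ∈ (I i).carrier := fun i => by
    by_cases h : (I i).HasSpan ε
    · obtain ⟨t, ht⟩ := h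
      exact ⟨t + ε, fun _ => by simpa using ht⟩
    · exact ⟨0, fun h' => absurd h' h⟩
  choose d hd using hex
  set S := Finset.univ.image d
  refine card_le_of_fibers _ _ S
    (fun i t => (t - ε ∈ (I i).carrier ∧ t ∈ (I i).carrier) ∧ ∀ u ∈ S, t < u → u ∉ (I i).carrier)
    (fun j t => (t - ε ∈ (J j).carrier ∧ t ∈ (J j).carrier) ∧ ∀ u ∈ S, t < u → u ∉ (J j).carrier)
    ?_ ?_ ?_ ?_
  · intro i hi
    have hi' := hd i hi
    have hne : (S.filter (· ∈ (I i).carrier)).Nonempty :=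
      ⟨d i, Finset.mem_filter.2 ⟨Finset.mem_image_of_mem _ (Finset.mem_univ _), hi'.2⟩⟩
    obtain ⟨hS, hI⟩ := Finset.mem_filter.1 (Finset.max'_mem _ hne)
    have hle : d i ≤ _ := Finset.le_max' _ _
      (Finset.mem_filter.2 ⟨Finset.mem_image_of_mem d (Finset.mem_univ i), hi'.2⟩)
    refine ⟨_, hS, ⟨(I i).ordConnected.out hi'.1 hI ⟨sub_le_sub_right hle _, ?_⟩, hI⟩, ?_⟩
    · linarith
    · intro u hu hlt huI
      exact absurd (Finset.le_max' _ _ (Finset.mem_filter.2 ⟨hu, huI⟩)) (not_le.2 hlt)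
  · rintro j t - ⟨h, -⟩
    exact ⟨t - ε, h.1, by simpa using h.2⟩
  · rintro j t t' ht ht' ⟨h1, h2⟩ ⟨h1', h2'⟩
    by_contra hne
    rcases lt_or_gt_of_ne hne with h | h
    · exact h2 t' ht' h h1'.2
    · exact h2' t ht h h1.2
  · intro t _
    convert card_le_of_injective hA hB f hf S (sub_le_self t hε)

open Classical in
/-- A quotient has at most as many bars of span `ε`. -/
lemma card_hasSpan_le_of_surjective {B C : PersistenceModule F} {I : ι → Bar} {J : κ → Bar}
    (hC : DecomposesAs C I) (hB : DecomposesAs B J) (g : B ⟶ C)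
    (hg : ∀ t, Function.Surjective (g.app t).hom) {ε : ℝ} (hε : 0 ≤ ε) :
    (Finset.univ.filter fun i => (I i).HasSpan ε).card ≤
      (Finset.univ.filter fun j => (J j).HasSpan ε).card := by
  -- Here the marks are left ends of spans, and a bar is assigned to the first point of `S` that it
  -- contains.
  have hex : ∀ i, ∃ t, (I i).HasSpan ε → t ∈ (I i).carrier ∧ t + ε ∈ (I i).carrier := fun i => by
    by_cases h : (I i).HasSpan ε
    · obtain ⟨t, ht⟩ := h
      exact ⟨t, fun _ => ht⟩
    · exact ⟨0, fun h' => absurd h' h⟩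
  choose d hd using hex
  set S := Finset.univ.image d
  refine card_le_of_fibers _ _ S
    (fun i t => (t ∈ (I i).carrier ∧ t + ε ∈ (I i).carrier) ∧ ∀ u ∈ S, u < t → u ∉ (I i).carrier)
    (fun j t => (t ∈ (J j).carrier ∧ t + ε ∈ (J j).carrier) ∧ ∀ u ∈ S, u < t → u ∉ (J j).carrier)
    ?_ ?_ ?_ ?_
  · intro i hi
    have hi' := hd i hi
    have hne : (S.filter (· ∈ (I i).carrier)).Nonempty :=
      ⟨d i, Finset.mem_filter.2 ⟨Finset.mem_image_of_mem _ (Finset.mem_univ _), hi'.1⟩⟩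
    obtain ⟨hS, hI⟩ := Finset.mem_filter.1 (Finset.min'_mem _ hne)
    have hle : _ ≤ d i := Finset.min'_le _ _
      (Finset.mem_filter.2 ⟨Finset.mem_image_of_mem d (Finset.mem_univ i), hi'.1⟩)
    refine ⟨_, hS, ⟨hI, (I i).ordConnected.out hI hi'.2 ⟨?_, add_le_add_left hle _⟩⟩, ?_⟩
    · linarith
    · intro u hu hlt huI
      exact absurd (Finset.min'_le _ _ (Finset.mem_filter.2 ⟨hu, huI⟩)) (not_le.2 hlt)
  · rintro j t - ⟨h, -⟩
    exact ⟨t, h⟩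
  · rintro j t t' ht ht' ⟨h1, h2⟩ ⟨h1', h2'⟩
    by_contra hne
    rcases lt_or_gt_of_ne hne with h | h
    · exact h2' t ht h h1.1
    · exact h2 t' ht' h h1'.1
  · intro t _
    convert card_le_of_surjective hC hB g hg S (le_add_of_nonneg_right hε : t ≤ t + ε)

end Counting

/-! ### Lengths of bars -/

lemma Bar.sub_le_length (K : Bar) {s t : ℝ} (hs : s ∈ K.carrier) (ht : t ∈ K.carrier) :
    ENNReal.ofReal (t - s) ≤ K.length := by
  have h1 : (t : EReal) ≤ K.death := le_sSup ⟨t, ht, rfl⟩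
  have h2 : K.birth ≤ (s : EReal) := sInf_le ⟨s, hs, rfl⟩
  have h3 := EReal.toENNReal_le_toENNReal (EReal.sub_le_sub h1 h2)
  rwa [← EReal.coe_sub, EReal.toENNReal_of_ne_top (EReal.coe_ne_top _), EReal.toReal_coe] at h3

lemma Bar.length_le {K : Bar} {ε : ℝ} (h : ∀ s ∈ K.carrier, ∀ t ∈ K.carrier, t - s ≤ ε) :
    K.length ≤ ENNReal.ofReal ε := by
  obtain ⟨a, ha⟩ := K.nonempty
  have hd : ∀ s ∈ K.carrier, K.death ≤ ((s + ε : ℝ) : EReal) := fun s hs =>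
    sSup_le fun _ ⟨t, ht, hx⟩ => hx ▸ EReal.coe_le_coe_iff.2 (by linarith [h s hs t ht])
  have hd' : (a : EReal) ≤ K.death := le_sSup ⟨a, ha, rfl⟩
  have hd0 : K.death ≠ ⊤ := ne_top_of_le_ne_top (EReal.coe_ne_top _) (hd a ha)
  have hd1 : K.death ≠ ⊥ := ne_bot_of_le_ne_bot (EReal.coe_ne_bot _) hd'
  lift K.death to ℝ using ⟨hd0, hd1⟩ with d hdd
  have hb : ((d - ε : ℝ) : EReal) ≤ K.birth := le_sInf fun _ ⟨t, ht, hx⟩ =>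
    hx ▸ EReal.coe_le_coe_iff.2 (by linarith [EReal.coe_le_coe_iff.1 (hd t ht)])
  rw [Bar.length, ← hdd]
  have h3 := EReal.toENNReal_le_toENNReal (EReal.sub_le_sub (le_refl (d : EReal)) hb)
  rwa [← EReal.coe_sub, EReal.toENNReal_of_ne_top (EReal.coe_ne_top _), EReal.toReal_coe,
    sub_sub_cancel] at h3

lemma Bar.hasSpan_of_lt_length {K : Bar} {ε : NNReal} (h : (ε : ℝ≥0∞) < K.length) :
    K.HasSpan ε := by
  by_contra hK
  refine absurd (Bar.length_le (K := K) (ε := ε) fun s hs t ht => ?_) (by simpa using h)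
  by_contra! hlt
  exact hK ⟨s, hs, K.ordConnected.out hs ht ⟨by simp, by linarith⟩⟩

lemma Bar.le_length_of_hasSpan {K : Bar} {ε : NNReal} (h : K.HasSpan ε) :
    (ε : ℝ≥0∞) ≤ K.length := by
  obtain ⟨t, h1, h2⟩ := h
  simpa using K.sub_le_length h1 h2

/-- Every r below the length yields some [t, t + r] inside the bar; conversely, volume is bounded by
diameter. This makes total length an integral. -/
lemma Bar.length_eq_volume (K : Bar) : K.length = MeasureTheory.volume K.carrier := by
  refine le_antisymm (ENNReal.le_of_forall_nnreal_lt fun r hr => ?_) ?_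
  · obtain ⟨t, h1, h2⟩ := K.hasSpan_of_lt_length hr
    calc (r : ℝ≥0∞) = MeasureTheory.volume (Set.Icc t (t + r)) := by simp
      _ ≤ _ := MeasureTheory.measure_mono (K.ordConnected.out h1 h2)
  · refine (Real.volume_le_diam _).trans (Metric.ediam_le fun s hs t ht => ?_)
    rw [edist_dist, Real.dist_eq]
    rcases abs_choice (s - t) with h | h <;> rw [h]
    · exact K.sub_le_length ht hs
    · rw [neg_sub]; exact K.sub_le_length hs ht

/-! ### Sums of largest elements -/

lemma sum_take_eq_sum_range (L : List ℝ≥0∞) (k : ℕ) :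
    (L.take k).sum = ∑ i ∈ Finset.range k, L.getD i 0 := by
  induction k with
  | zero => simp
  | succ k ih =>
    rw [Finset.sum_range_succ, ← ih]
    rcases lt_or_ge k L.length with h | h
    · rw [List.sum_take_succ L k h, List.getD_eq_getElem _ _ h]
    · rw [List.getD_eq_default _ _ h, List.take_of_length_le h,
        List.take_of_length_le (h.trans (Nat.le_succ k)), add_zero]

/-- In a decreasing list the entries above ε form an initial segment; the default 0 beyond the end
never exceeds ε. -/
lemma lt_getD_iff {L : List ℝ≥0∞} (hL : L.Pairwise (fun a b => b ≤ a)) (ε : ℝ≥0∞) (i : ℕ) :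
    ε < L.getD i 0 ↔ i < L.countP (fun x => ε < x) := by
  induction L generalizing i with
  | nil => simp
  | cons a L ih =>
    rw [List.pairwise_cons] at hL
    rw [List.countP_cons]
    by_cases ha : ε < a
    · cases i with
      | zero => simp [ha]
      | succ i => simpa [ha] using ih hL.2 i
    · have h0 : L.countP (fun x => ε < x) = 0 := by
        rw [List.countP_eq_zero]
        intro b hb
        simpa using (hL.1 b hb).trans (not_lt.1 ha)
      cases i with
      | zero => simp [ha, h0]
      | succ i => simpa [ha, h0] using ih hL.2 i

/-- The sorted lists are compared entry by entry: if the i-th entry of `s` exceeded that of `t`, the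
latter, taken as ε, would contradict the counts. -/
lemma topSum_le_topSum {s t : Multiset ℝ≥0∞}
    (h : ∀ ε : ℝ≥0∞, ε ≠ ⊤ → s.countP (fun x => ε < x) ≤ t.countP (fun x => ε < x)) (k : ℕ) :
    topSum k s ≤ topSum k t := by
  simp only [topSum]
  rw [sum_take_eq_sum_range, sum_take_eq_sum_range]
  refine Finset.sum_le_sum fun i _ => ?_
  by_contra! hlt
  have h1 := (lt_getD_iff (s.pairwise_sort _) _ i).1 hlt
  have h2 := h _ hlt.ne_top
  generalize ht : (t.sort (fun a b => b ≤ a)).getD i 0 = ε at h1 h2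
  rw [← s.sort_eq (fun a b => b ≤ a), ← t.sort_eq (fun a b => b ≤ a), Multiset.coe_countP,
    Multiset.coe_countP] at h2
  exact absurd ((lt_getD_iff (t.pairwise_sort _) _ i).2 (h1.trans_le h2)) ht.not_gt

lemma topSum_eq_sum {s : Multiset ℝ≥0∞} {k : ℕ} (h : Multiset.card s ≤ k) :
    topSum k s = s.sum := by
  rw [topSum, List.take_of_length_le (by simpa using h), ← Multiset.sum_coe, Multiset.sort_eq]

lemma sum_le_topSum {s : Multiset ℝ≥0∞} {k : ℕ} (h : s.countP (fun x => 0 < x) ≤ k) :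
    s.sum ≤ topSum k s := by
  have h1 : s.sum = (s.filter (fun x => 0 < x)).sum := by
    conv_lhs => rw [← Multiset.filter_add_not (fun x => 0 < x) s, Multiset.sum_add]
    rw [Multiset.sum_eq_zero (s := s.filter fun x => ¬ 0 < x), add_zero]
    intro x hx
    simpa using (Multiset.mem_filter.1 hx).2
  rw [h1, ← topSum_eq_sum (k := k) (by rwa [← Multiset.countP_eq_card_filter])]
  exact topSum_le_topSum (fun ε _ => Multiset.countP_le_of_le _ (Multiset.filter_le _ _)) k

lemma exists_finset_sum_eq_topSum {ι : Type*} [Fintype ι] (f : ι → ℝ≥0∞) (k : ℕ) :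
    ∃ T : Finset ι, T.card ≤ k ∧ ∑ i ∈ T, f i = topSum k (Finset.univ.val.map f) := by
  classical
  obtain ⟨l, hl⟩ : ∃ l : List ι, (l : Multiset ι) = Finset.univ.val := Quot.exists_rep _
  have hp : (((Finset.univ.val.map f).sort (fun a b => b ≤ a)).Perm (l.map f)) := by
    rw [← Multiset.coe_eq_coe, Multiset.sort_eq, ← hl, Multiset.map_coe]
  obtain ⟨l', hl', hs⟩ := (congrFun₂ (List.eq_map_comp_perm f) _ _).mpr hp
  have hnd : (l'.take k).Nodup := by
    refine List.Nodup.sublist (List.take_sublist k l') (hs.nodup_iff.2 ?_)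
    rw [← Multiset.coe_nodup, hl]
    exact Finset.univ.nodup
  refine ⟨(l'.take k).toFinset, ?_, ?_⟩
  · exact (List.toFinset_card_le _).trans (by simp)
  · rw [List.sum_toFinset f hnd, topSum, hl', List.map_take]

/-! ### Constructible modules -/

/-- A morphism of persistence modules from a natural family of linear maps. -/
def homMk {M N : PersistenceModule F} (φ : ∀ t, M.obj t →ₗ[F] N.obj t)
    (h : ∀ s t (hst : s ≤ t) x, φ t (structureMap M hst x) = structureMap N hst (φ s x)) :
    M ⟶ N where
  app t := ModuleCat.ofHom (φ t)
  naturality s t f := by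
    ext x
    exact h s t (leOfHom f) x

@[simp] lemma homMk_app_hom {M N : PersistenceModule F} (φ : ∀ t, M.obj t →ₗ[F] N.obj t) (h)
    (t : ℝ) : ((homMk φ h).app t).hom = φ t := rfl

lemma hom_ext_apply {M N : PersistenceModule F} {f g : M ⟶ N}
    (h : ∀ t x, (f.app t).hom x = (g.app t).hom x) : f = g := by
  ext t x
  exact h t x

/-- The submodule of a persistence module given by a compatible family of subspaces. -/
def subModule (M : PersistenceModule F) (W : ∀ t, Submodule F (M.obj t))
    (hW : ∀ s t (h : s ≤ t) x, x ∈ W s → structureMap M h x ∈ W t) : PersistenceModule F where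
  obj t := ModuleCat.of F (W t)
  map {s t} f := ModuleCat.ofHom ((structureMap M (leOfHom f)).restrict (hW s t (leOfHom f)))
  map_id t := ModuleCat.hom_ext <| LinearMap.ext fun x => Subtype.ext <|
    LinearMap.congr_fun (structureMap_self M (le_refl t)) x.1
  map_comp f g := ModuleCat.hom_ext <| LinearMap.ext fun x => Subtype.ext
    (structureMap_comp_apply M (leOfHom f) (leOfHom g) x.1).symm

/-- The inclusion of a submodule. -/
def subModuleIncl (M : PersistenceModule F) (W : ∀ t, Submodule F (M.obj t))
    (hW : ∀ s t (h : s ≤ t) x, x ∈ W s → structureMap M h x ∈ W t) : subModule M W hW ⟶ M :=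
  homMk (fun t => (W t).subtype) fun _ _ _ _ => rfl

lemma subModuleIncl_injective (M : PersistenceModule F) (W : ∀ t, Submodule F (M.obj t)) (hW)
    (t : ℝ) : Function.Injective ((subModuleIncl M W hW).app t).hom :=
  Subtype.val_injective

/-- The factorization of a morphism through a submodule. -/
def subModuleLift {M N : PersistenceModule F} (W : ∀ t, Submodule F (M.obj t))
    (hW : ∀ s t (h : s ≤ t) x, x ∈ W s → structureMap M h x ∈ W t) (f : N ⟶ M)
    (hf : ∀ t x, (f.app t).hom x ∈ W t) : N ⟶ subModule M W hW :=
  homMk (fun t => (f.app t).hom.codRestrict (W t) (hf t)) fun _ _ h x =>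
    Subtype.ext (app_structureMap f h x)

/-- The kernel of a morphism, computed pointwise. -/
abbrev kerModule {M N : PersistenceModule F} (f : M ⟶ N) : PersistenceModule F :=
  subModule M (fun t => LinearMap.ker (f.app t).hom) fun s t h x hx => by
    rw [LinearMap.mem_ker, app_structureMap, LinearMap.mem_ker.1 hx, map_zero]

/-- The image of a morphism, computed pointwise. -/
abbrev rangeModule {M N : PersistenceModule F} (f : M ⟶ N) : PersistenceModule F :=
  subModule N (fun t => LinearMap.range (f.app t).hom) fun s t h x hx => by
    obtain ⟨y, rfl⟩ := hx
    exact ⟨_, app_structureMap f h y⟩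

/-! ### Modules constant on the fibers of an encoding -/

/-- `M` is pointwise finite-dimensional, and constant on the fibers of `e`. -/
structure ConstantOnFibers (e : ℝ → ℕ) (M : PersistenceModule F) : Prop where
  finiteDimensional : ∀ t, FiniteDimensional F (M.obj t)
  bijective : ∀ s t (h : s ≤ t), e s = e t → Function.Bijective (structureMap M h)

lemma ConstantOnFibers.ker {e : ℝ → ℕ} {M N : PersistenceModule F}
    (hM : ConstantOnFibers e M) (hN : ConstantOnFibers e N) (f : M ⟶ N) :
    ConstantOnFibers e (kerModule f) where
  finiteDimensional t := by
    have := hM.finiteDimensional t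
    exact inferInstanceAs (FiniteDimensional F (LinearMap.ker (f.app t).hom))
  bijective s t h hst := by
    refine ⟨fun x y hxy => Subtype.ext ((hM.bijective s t h hst).1 (congrArg Subtype.val hxy)),
      fun y => ?_⟩
    obtain ⟨x, hx⟩ := (hM.bijective s t h hst).2 y.1
    refine ⟨⟨x, (hN.bijective s t h hst).1 ?_⟩, Subtype.ext hx⟩
    rw [← app_structureMap, hx, map_zero]
    exact y.2

lemma ConstantOnFibers.range {e : ℝ → ℕ} {M N : PersistenceModule F}
    (hM : ConstantOnFibers e M) (hN : ConstantOnFibers e N) (f : M ⟶ N) :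
    ConstantOnFibers e (rangeModule f) where
  finiteDimensional t := by
    have := hN.finiteDimensional t
    exact inferInstanceAs (FiniteDimensional F (LinearMap.range (f.app t).hom))
  bijective s t h hst := by
    refine ⟨fun x y hxy => Subtype.ext ((hN.bijective s t h hst).1 (congrArg Subtype.val hxy)),
      ?_⟩
    rintro ⟨_, y, rfl⟩
    obtain ⟨x, rfl⟩ := (hM.bijective s t h hst).2 y
    exact ⟨⟨_, x, rfl⟩, Subtype.ext (app_structureMap f h x).symm⟩

lemma ConstantOnFibers.of_retract {e : ℝ → ℕ} {M N : PersistenceModule F}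
    (hM : ConstantOnFibers e M) (j : N ⟶ M) (q : M ⟶ N) (hjq : j ≫ q = 𝟙 N) :
    ConstantOnFibers e N := by
  have hid : ∀ t x, (q.app t).hom ((j.app t).hom x) = x := fun t x =>
    congrArg (fun f => (f.app t).hom x) hjq
  have hinj : ∀ t, Function.Injective (j.app t).hom := fun t =>
    Function.LeftInverse.injective (hid t)
  refine ⟨fun t => ?_, fun s t h hst => ⟨fun x y hxy => ?_, fun y => ?_⟩⟩
  · have := hM.finiteDimensional t
    exact FiniteDimensional.of_injective _ (hinj t)
  · refine hinj s ((hM.bijective s t h hst).1 ?_)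
    rw [← app_structureMap, ← app_structureMap, hxy]
  · obtain ⟨x, hx⟩ := (hM.bijective s t h hst).2 ((j.app t).hom y)
    exact ⟨(q.app s).hom x, by rw [← app_structureMap, hx, hid]⟩

lemma ConstantOnFibers.mono {e e' : ℝ → ℕ} {M : PersistenceModule F}
    (hM : ConstantOnFibers e M) (h : ∀ s t, s ≤ t → e' s = e' t → e s = e t) :
    ConstantOnFibers e' M :=
  ⟨hM.finiteDimensional, fun s t hst he => hM.bijective s t hst (h s t hst he)⟩

lemma apply_max {e : ℝ → ℕ} (he : Monotone e) {x y : ℝ} (h : e x ≤ e y) :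
    e y = e (max x y) := by
  rw [he.map_max, max_eq_right h]

section Transport

variable {e : ℝ → ℕ} {M : PersistenceModule F} (hM : ConstantOnFibers e M) (he : Monotone e)

/-- The map from the space at `x` to that at `y`, for `e x ≤ e y`. -/
def transport {x y : ℝ} (h : e x ≤ e y) : M.obj x →ₗ[F] M.obj y :=
  (LinearEquiv.ofBijective (structureMap M (le_max_right x y))
    (hM.bijective _ _ _ (apply_max he h))).symm.toLinearMap ∘ₗ structureMap M (le_max_left x y)

lemma structureMap_transport_max {x y : ℝ} (h : e x ≤ e y) (v : M.obj x) :
    structureMap M (le_max_right x y) (transport hM he h v) =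
      structureMap M (le_max_left x y) v :=
  LinearEquiv.apply_symm_apply (LinearEquiv.ofBijective (structureMap M (le_max_right x y))
    (hM.bijective _ _ _ (apply_max he h))) _

/-- Since e x ≤ e y does not imply x ≤ y, identities between transports are checked after moving to
a later parameter, where they become functoriality of `M`. -/
lemma structureMap_transport {x y u : ℝ} (h : e x ≤ e y) (hx : x ≤ u) (hy : y ≤ u)
    (v : M.obj x) : structureMap M hy (transport hM he h v) = structureMap M hx v := by
  rw [← structureMap_comp_apply M (le_max_right x y) (max_le hx hy),
    ← structureMap_comp_apply M (le_max_left x y) (max_le hx hy), structureMap_transport_max]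

lemma transport_of_le {x y : ℝ} (h : e x ≤ e y) (hxy : x ≤ y) (v : M.obj x) :
    transport hM he h v = structureMap M hxy v := by
  rw [← structureMap_transport hM he h hxy le_rfl, structureMap_self]
  rfl

lemma transport_transport {x y z : ℝ} (h : e x ≤ e y) (h' : e y ≤ e z) (v : M.obj x) :
    transport hM he h' (transport hM he h v) = transport hM he (h.trans h') v := by
  have hu : e z = e (max (max x y) z) := apply_max he (by rw [← apply_max he h]; exact h')
  have hx : x ≤ max (max x y) z := (le_max_left _ _).trans (le_max_left _ _)
  have hy : y ≤ max (max x y) z := (le_max_right _ _).trans (le_max_left _ _)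
  refine (hM.bijective z _ (le_max_right _ _) hu).1 ?_
  rw [structureMap_transport hM he h' hy, structureMap_transport hM he h hx,
    structureMap_transport hM he (h.trans h') hx]

lemma transport_self {x : ℝ} (h : e x ≤ e x) (v : M.obj x) : transport hM he h v = v := by
  rw [transport_of_le hM he h le_rfl, structureMap_self]
  rfl

/-- The module induced on the values of the encoding, by a choice of representatives. -/
def encodedModule (r : Set.range e → ℝ) (hr : ∀ p, e (r p) = p) :
    Set.range e ⥤ ModuleCat.{u} F where
  obj p := M.obj (r p)
  map {p q} f := ModuleCat.ofHom (transport hM he (by rw [hr, hr]; exact leOfHom f))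
  map_id p := ModuleCat.hom_ext <| LinearMap.ext fun v => transport_self hM he le_rfl v
  map_comp {p q s} f g := ModuleCat.hom_ext <| LinearMap.ext fun v =>
    (transport_transport hM he (by rw [hr, hr]; exact leOfHom f)
      (by rw [hr, hr]; exact leOfHom g) v).symm

/-- Spaces over the same fiber of the encoding are isomorphic. -/
def transportEquiv {x y : ℝ} (h : e x = e y) : M.obj x ≃ₗ[F] M.obj y :=
  { transport hM he h.le with
    invFun := transport hM he h.ge
    left_inv := fun v => (transport_transport hM he h.le h.ge v).trans
      (transport_self hM he le_rfl v)
    right_inv := fun v => (transport_transport hM he h.ge h.le v).trans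
      (transport_self hM he le_rfl v) }

end Transport

lemma finitelyEncoded_of_constantOnFibers {e : ℝ → ℕ} {M : PersistenceModule F}
    (hM : ConstantOnFibers e M) (he : Monotone e) {n : ℕ} (hn : ∀ t, e t < n) :
    FinitelyEncoded F M := by
  have hfin : (Set.range e).Finite :=
    (Set.finite_lt_nat n).subset (by rintro _ ⟨t, rfl⟩; exact hn t)
  choose r hr using fun p : Set.range e => p.2
  let e' : ℝ →o Set.range e := ⟨Set.rangeFactorization e, fun s t h => he h⟩
  have hr' : ∀ t, e t = e (r (e' t)) := fun t => (hr (e' t)).symm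
  refine ⟨Set.range e, inferInstance, hfin, e', encodedModule hM he r hr,
    fun p => hM.finiteDimensional (r p),
    ⟨NatIso.ofComponents (fun t => (transportEquiv hM he (hr' t)).toModuleIso) ?_⟩⟩
  intro s t f
  refine ModuleCat.hom_ext (LinearMap.ext fun v => ?_)
  have h1 : e (r (e' s)) ≤ e (r (e' t)) := by rw [← hr', ← hr']; exact he (leOfHom f)
  change transport hM he (hr' t).le (structureMap M (leOfHom f) v) =
    transport hM he h1 (transport hM he (hr' s).le v)
  rw [← transport_of_le hM he (he (leOfHom f)), transport_transport, transport_transport]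

/-- A numerical code for a point of the finite poset is the size of its down-set. Along comparable
points, equal sizes force equal down-sets and hence equal points. -/
lemma FinitelyEncoded.exists_constantOnFibers {M : PersistenceModule F}
    (hM : FinitelyEncoded F M) :
    ∃ (e : ℝ → ℕ) (n : ℕ), Monotone e ∧ (∀ t, e t < n) ∧ ConstantOnFibers e M := by
  obtain ⟨P, _, _, e, N, hN, ⟨φ⟩⟩ := hM
  have hfin : ∀ t, (Set.Iic (e t)).Finite := fun t => Set.toFinite _
  have hmono : Monotone fun t => (Set.Iic (e t)).ncard := fun s t h =>
    Set.ncard_le_ncard (Set.Iic_subset_Iic.2 (e.monotone h)) (hfin t)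
  refine ⟨fun t => (Set.Iic (e t)).ncard, Nat.card P + 1, hmono, fun t => ?_, fun t => ?_,
    fun s t h hst => ?_⟩
  · rw [Nat.lt_succ_iff, ← Set.ncard_univ]
    exact Set.ncard_le_ncard (Set.subset_univ _)
  · have : FiniteDimensional F ((e.monotone.functor ⋙ N).obj t) := hN (e t)
    exact FiniteDimensional.of_injective (φ.hom.app t).hom
      ((ModuleCat.mono_iff_injective (φ.hom.app t)).1 inferInstance)
  · have h1 : e s = e t := Set.Iic_injective
      (Set.eq_of_subset_of_ncard_le (Set.Iic_subset_Iic.2 (e.monotone h)) hst.ge (hfin t))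
    have h2 : IsIso ((e.monotone.functor ⋙ N).map (homOfLE h)) := by
      have h3 : e.monotone.functor.map (homOfLE h) = eqToHom h1 := Subsingleton.elim _ _
      rw [Functor.comp_map, h3]
      exact inferInstanceAs (IsIso (N.map (eqToHom h1)))
    have h4 : IsIso (M.map (homOfLE h)) := by
      have h5 := φ.hom.naturality (homOfLE h)
      have h6 : M.map (homOfLE h) = (φ.app s).hom ≫ (e.monotone.functor ⋙ N).map (homOfLE h) ≫
          (φ.app t).inv := by
        rw [← Category.assoc, Iso.eq_comp_inv]
        exact h5
      rw [h6]
      infer_instance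
    exact ConcreteCategory.bijective_of_isIso (M.map (homOfLE h))

/-- Two encodings can be merged. -/
lemma exists_common_encoding {M N : PersistenceModule F} (hM : FinitelyEncoded F M)
    (hN : FinitelyEncoded F N) : ∃ (e : ℝ → ℕ) (n : ℕ), Monotone e ∧ (∀ t, e t < n) ∧
      ConstantOnFibers e M ∧ ConstantOnFibers e N := by
  obtain ⟨e, n, he, hn, hM⟩ := hM.exists_constantOnFibers
  obtain ⟨e', n', he', hn', hN⟩ := hN.exists_constantOnFibers
  -- For monotone codes, the sum is constant between s and t only if both summands are.
  have key : ∀ s t, s ≤ t → e s + e' s = e t + e' t → e s = e t ∧ e' s = e' t := fun s t h h' => by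
    have h1 := he h
    have h2 := he' h
    omega
  refine ⟨fun t => e t + e' t, n + n', fun s t h => add_le_add (he h) (he' h), fun t => ?_,
    hM.mono fun s t h h' => (key s t h h').1, hN.mono fun s t h h' => (key s t h h').2⟩
  have := hn t
  have := hn' t
  show e t + e' t < n + n'
  omega

/-! ### Existence of barcodes -/

lemma exists_forall_apply_le {α : Type*} (g : α → ℕ) {T : Set α} (hT : T.Nonempty) :
    ∃ s ∈ T, ∀ t ∈ T, g s ≤ g t := by
  obtain ⟨s, hs, h⟩ := (measure g).wf.has_min T hT
  exact ⟨s, hs, fun t ht => not_lt.1 (h t ht)⟩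

/-- A functional with values in the space of an interval module, at a parameter of the bar. -/
def intervalLift {V : Type*} [AddCommGroup V] [Module F V] {I : Bar} {t : ℝ}
    (ht : t ∈ I.carrier) (f : V →ₗ[F] F) : V →ₗ[F] (intervalModule F I).obj t :=
  f.codRestrict (intervalSpace F I t) fun _ => Or.inl ht

lemma intervalCoord_intervalLift {V : Type*} [AddCommGroup V] [Module F V] {I : Bar} {t : ℝ}
    (ht : t ∈ I.carrier) (f : V →ₗ[F] F) (x : V) :
    intervalCoord I t (intervalLift ht f x) = f x := rfl

open Classical in
/-- A nonzero constructible module has an interval module as a direct summand: take a vector `v`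
born at the first code, and a functional that is nonzero on `v` at the last code which `v`
reaches. -/
lemma ConstantOnFibers.exists_summand {e : ℝ → ℕ} {M : PersistenceModule F}
    (hM : ConstantOnFibers e M) (he : Monotone e) {n : ℕ} (hn : ∀ t, e t < n)
    (hne : ∃ t, ∃ x : M.obj t, x ≠ 0) :
    ∃ (I : Bar) (a : intervalModule F I ⟶ M) (p : M ⟶ intervalModule F I), a ≫ p = 𝟙 _ ∧
      ∀ s t, e s = e t → s ∈ I.carrier → t ∈ I.carrier := by
  obtain ⟨s₀, ⟨v, hv⟩, hs₀⟩ := exists_forall_apply_le e (T := {t | ∃ x : M.obj t, x ≠ 0}) hne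
  have hzero : ∀ t, e t < e s₀ → ∀ x : M.obj t, x = 0 := fun t ht x => by
    by_contra hx
    exact absurd (hs₀ t ⟨x, hx⟩) (not_le.2 ht)
  -- Codes are below n, so minimizing n - e t selects the largest code at which `v` survives.
  obtain ⟨s₁, ⟨h₁, hv₁⟩, hs₁⟩ := exists_forall_apply_le (fun t => n - e t)
    (T := {t | ∃ h : e s₀ ≤ e t, transport hM he h v ≠ 0})
    ⟨s₀, le_rfl, by rwa [transport_self hM he]⟩
  have hlast : ∀ t (h : e s₀ ≤ e t), e s₁ < e t → transport hM he h v = 0 := fun t h ht => by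
    by_contra hx
    have h1 := hs₁ t ⟨h, hx⟩
    have h2 := hn t
    change n - e s₁ ≤ n - e t at h1
    omega
  obtain ⟨φ, hφ⟩ := Module.Projective.exists_dual_eq_one F hv₁
  obtain ⟨I, hI⟩ : ∃ I : Bar, ∀ t, t ∈ I.carrier ↔ e s₀ ≤ e t ∧ e t ≤ e s₁ :=
    ⟨⟨e ⁻¹' Set.Icc (e s₀) (e s₁), Set.ordConnected_Icc.preimage_mono he, s₀, le_rfl, h₁⟩,
      fun _ => Iff.rfl⟩
  have hfst : ∀ t, t ∈ I.carrier → e s₀ ≤ e t := fun t ht => ((hI t).1 ht).1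
  have hsnd : ∀ t, t ∈ I.carrier → e t ≤ e s₁ := fun t ht => ((hI t).1 ht).2
  have hnot : ∀ t, t ∉ I.carrier → e s₀ ≤ e t → e s₁ < e t := fun t ht h =>
    not_le.1 fun h' => ht ((hI t).2 ⟨h, h'⟩)
  have zero : ∀ t, t ∉ I.carrier → ∀ x : (intervalModule F I).obj t, x = 0 := fun t ht x =>
    intervalCoord_injective I t (by rw [intervalCoord_eq_zero ht, map_zero])
  -- The generator goes to the transports of `v`. Naturality at the end of the bar holds because `v`
  -- has died there.
  let a : intervalModule F I ⟶ M := homMk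
    (fun t => if h : e s₀ ≤ e t then
      LinearMap.toSpanSingleton F _ (transport hM he h v) ∘ₗ intervalCoord I t else 0) <| by
    intro s t hst x
    by_cases hs : s ∈ I.carrier
    · have hst' : e s₀ ≤ e t := (hfst s hs).trans (he hst)
      rw [dif_pos (hfst s hs), dif_pos hst', LinearMap.comp_apply, LinearMap.comp_apply,
        LinearMap.toSpanSingleton_apply, LinearMap.toSpanSingleton_apply, map_smul,
        ← transport_of_le hM he (he hst) hst, transport_transport]
      by_cases ht : t ∈ I.carrier
      · rw [intervalCoord_structureMap hst ht]
      · rw [hlast t hst' (hnot t ht hst'), smul_zero, smul_zero]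
    · rw [zero s hs x]
      simp only [map_zero]
  -- Vectors are transported forward to s₁ and evaluated by `φ`. Naturality at the start of the bar
  -- holds because `M` vanishes at smaller codes.
  let p : M ⟶ intervalModule F I := homMk
    (fun t => if h : t ∈ I.carrier then intervalLift h (φ ∘ₗ transport hM he (hsnd t h)) else 0)
      <| by
    intro s t hst x
    by_cases ht : t ∈ I.carrier
    · by_cases hs : s ∈ I.carrier
      · refine intervalCoord_injective I t ?_
        rw [intervalCoord_structureMap hst ht, dif_pos hs, dif_pos ht, intervalCoord_intervalLift,
          intervalCoord_intervalLift, LinearMap.comp_apply, LinearMap.comp_apply,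
          ← transport_of_le hM he (he hst) hst, transport_transport]
      · have hlt : e s < e s₀ :=
          not_le.1 fun h => hs ((hI s).2 ⟨h, (he hst).trans (hsnd t ht)⟩)
        rw [hzero s hlt x]
        simp only [map_zero]
    · exact (zero t ht _).trans (zero t ht _).symm
  refine ⟨I, a, p, hom_ext_apply fun t x => ?_, fun s t hst hs => ?_⟩
  · by_cases ht : t ∈ I.carrier
    · refine intervalCoord_injective I t ?_
      have ha : (a.app t).hom x = intervalCoord I t x • transport hM he (hfst t ht) v :=
        LinearMap.congr_fun (dif_pos (hfst t ht)) x
      have hp : ∀ y, (p.app t).hom y = intervalLift ht (φ ∘ₗ transport hM he (hsnd t ht)) y :=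
        fun y => LinearMap.congr_fun (dif_pos ht) y
      change intervalCoord I t ((p.app t).hom ((a.app t).hom x)) = _
      rw [ha, hp, intervalCoord_intervalLift, LinearMap.comp_apply, map_smul,
        transport_transport, map_smul, hφ, smul_eq_mul, mul_one]
      rfl
    · exact (zero t ht _).trans (zero t ht _).symm
  · rw [hI] at hs ⊢
    rwa [← hst]

lemma DecomposesAs.option {κ : Type} [Fintype κ] {M K : PersistenceModule F} {I : Bar}
    {J : κ → Bar} (hK : DecomposesAs K J) (a : intervalModule F I ⟶ M)
    (p : M ⟶ intervalModule F I) (k : K ⟶ M) (q : M ⟶ K) (hap : a ≫ p = 𝟙 _)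
    (hkq : k ≫ q = 𝟙 _) (hkp : k ≫ p = 0) (haq : a ≫ q = 0) (htot : p ≫ a + q ≫ k = 𝟙 M) :
    DecomposesAs M (fun o : Option κ => o.elim I J) := by
  obtain ⟨a', p', h1, h2, h3⟩ := hK
  refine ⟨fun o => match o with
      | none => a
      | some j => a' j ≫ k,
    fun o => match o with
      | none => p
      | some j => q ≫ p' j, ?_, ?_, ?_⟩
  · rintro (_ | j)
    · exact hap
    · change (a' j ≫ k) ≫ q ≫ p' j = _
      rw [Category.assoc, reassoc_of% hkq, h1]
      rfl
  · rintro (_ | i) (_ | j) hij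
    · exact absurd rfl hij
    · change a ≫ q ≫ p' j = 0
      rw [reassoc_of% haq, zero_comp]
    · change (a' i ≫ k) ≫ p = 0
      rw [Category.assoc, hkp, comp_zero]
    · change (a' i ≫ k) ≫ q ≫ p' j = 0
      rw [Category.assoc, reassoc_of% hkq, h2]
      exact fun h => hij (congrArg some h)
  · rw [Fintype.sum_option]
    change p ≫ a + ∑ j, (q ≫ p' j) ≫ a' j ≫ k = _
    have : ∑ j, (q ≫ p' j) ≫ a' j ≫ k = q ≫ (∑ j, p' j ≫ a' j) ≫ k := by
      simp only [Preadditive.comp_sum, Preadditive.sum_comp, Category.assoc]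
    rw [this, h3, Category.id_comp, htot]

/-- A split epimorphism `p` gives M = im a ⊕ ker p, with 1 - p ≫ a as the projection to the kernel.
-/
lemma DecomposesAs.of_splitting {κ : Type} [Fintype κ] {M : PersistenceModule F} {I : Bar}
    {J : κ → Bar} (a : intervalModule F I ⟶ M) (p : M ⟶ intervalModule F I)
    (hap : a ≫ p = 𝟙 _) (hK : DecomposesAs (kerModule p) J) :
    DecomposesAs M (fun o : Option κ => o.elim I J) := by
  have hap' : ∀ t x, (p.app t).hom ((a.app t).hom x) = x := fun t x =>
    congrArg (fun f => (f.app t).hom x) hap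
  refine hK.option a p (subModuleIncl _ _ _) (subModuleLift _ _ (𝟙 M - p ≫ a) fun t x => ?_) hap
    ?_ ?_ ?_ ?_
  · change (p.app t).hom (x - (a.app t).hom ((p.app t).hom x)) = 0
    rw [map_sub, hap', sub_self]
  · refine hom_ext_apply fun t x => Subtype.ext ?_
    change x.1 - (a.app t).hom ((p.app t).hom x.1) = x.1
    rw [LinearMap.mem_ker.1 x.2, map_zero, sub_zero]
  · exact hom_ext_apply fun t x => x.2
  · refine hom_ext_apply fun t x => Subtype.ext ?_
    change (a.app t).hom x - (a.app t).hom ((p.app t).hom ((a.app t).hom x)) = 0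
    rw [hap', sub_self]
  · refine hom_ext_apply fun t x => ?_
    change (a.app t).hom ((p.app t).hom x) + (x - (a.app t).hom ((p.app t).hom x)) = x
    rw [add_sub_cancel]

lemma constantOnFibers_intervalModule {e : ℝ → ℕ} {I : Bar}
    (h : ∀ s t, s ≤ t → e s = e t → (s ∈ I.carrier ↔ t ∈ I.carrier)) :
    ConstantOnFibers e (intervalModule F I) where
  finiteDimensional t := FiniteDimensional.of_injective _ (intervalCoord_injective I t)
  bijective s t hst hest := by
    by_cases ht : t ∈ I.carrier
    · refine ⟨fun x y hxy => intervalCoord_injective I s ?_, fun y => ?_⟩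
      · rw [← intervalCoord_structureMap hst ht, ← intervalCoord_structureMap hst ht, hxy]
      · obtain ⟨x, hx⟩ := exists_intervalCoord_eq (I := I) (t := s) (c := intervalCoord I t y)
          fun hs => absurd ((h s t hst hest).2 ht) hs
        exact ⟨x, intervalCoord_injective I t (by rw [intervalCoord_structureMap hst ht, hx])⟩
    · have hs : s ∉ I.carrier := fun hs => ht ((h s t hst hest).1 hs)
      refine ⟨fun x y _ => intervalCoord_injective I s ?_, fun y =>
        ⟨0, intervalCoord_injective I t ?_⟩⟩
      · rw [intervalCoord_eq_zero hs, intervalCoord_eq_zero hs]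
      · rw [intervalCoord_eq_zero ht, intervalCoord_eq_zero ht]

/-- Induction on the sum of dimensions at representatives of the codes. Splitting off a bar leaves a
kernel that is constant on the same fibers and strictly smaller at the code of any point of the bar.
-/
lemma ConstantOnFibers.exists_decomposesAs {e : ℝ → ℕ} {M : PersistenceModule F}
    (hM : ConstantOnFibers e M) (he : Monotone e) {n : ℕ} (hn : ∀ t, e t < n) :
    ∃ (ι : Type) (_ : Fintype ι) (I : ι → Bar), DecomposesAs M I := by
  obtain ⟨r, hr⟩ : ∃ r : ℕ → ℝ, ∀ t, e (r (e t)) = e t :=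
    ⟨Function.invFun e, fun t => Function.invFun_eq ⟨t, rfl⟩⟩
  induction hd : ∑ i ∈ Finset.range n, Module.finrank F (M.obj (r i)) using
    Nat.strong_induction_on generalizing M with
  | _ d ih =>
  by_cases hne : ∃ t, ∃ x : M.obj t, x ≠ 0
  · obtain ⟨I, a, p, hap, hI⟩ := hM.exists_summand he hn hne
    have hIC : ConstantOnFibers e (intervalModule F I) :=
      constantOnFibers_intervalModule fun s t _ h => ⟨hI s t h, hI t s h.symm⟩
    have hle : ∀ t, Module.finrank F ((kerModule p).obj t) ≤ Module.finrank F (M.obj t) :=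
      fun t => by
        have := hM.finiteDimensional t
        exact Submodule.finrank_le (LinearMap.ker (p.app t).hom)
    obtain ⟨t, ht⟩ := I.nonempty
    have hlt : Module.finrank F ((kerModule p).obj (r (e t))) <
        Module.finrank F (M.obj (r (e t))) := by
      have := hM.finiteDimensional (r (e t))
      refine Submodule.finrank_lt (s := LinearMap.ker (p.app (r (e t))).hom) fun htop => ?_
      obtain ⟨x, hx⟩ := exists_intervalCoord_eq (F := F) (I := I) (t := r (e t)) (c := 1)
        fun h => absurd (hI _ _ (hr t).symm ht) h
      have h1 : (p.app (r (e t))).hom ((a.app (r (e t))).hom x) = x :=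
        congrArg (fun f => (f.app (r (e t))).hom x) hap
      have h2 : (a.app (r (e t))).hom x ∈ LinearMap.ker (p.app (r (e t))).hom :=
        htop ▸ Submodule.mem_top
      rw [LinearMap.mem_ker.1 h2] at h1
      rw [← h1, map_zero] at hx
      exact zero_ne_one hx
    obtain ⟨κ, _, J, hJ⟩ := ih _ (hd ▸ Finset.sum_lt_sum (fun i _ => hle (r i))
      ⟨e t, Finset.mem_range.2 (hn t), hlt⟩) (hM.ker hIC p) rfl
    exact ⟨Option κ, inferInstance, _, hJ.of_splitting a p hap⟩
  · push Not at hne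
    refine ⟨Empty, inferInstance, Empty.elim, fun i => i.elim, fun i => i.elim, fun i => i.elim,
      fun i => i.elim, hom_ext_apply fun t x => ?_⟩
    rw [hne t x, map_zero, map_zero]

lemma FinitelyEncoded.exists_decomposesAs {M : PersistenceModule F} (hM : FinitelyEncoded F M) :
    ∃ (ι : Type) (_ : Fintype ι) (I : ι → Bar), DecomposesAs M I := by
  obtain ⟨e, n, he, hn, h⟩ := hM.exists_constantOnFibers
  exact h.exists_decomposesAs he hn

lemma isBarcode_iff {M : PersistenceModule F} {B : Multiset Bar} :
    IsBarcode M B ↔ ∃ (ι : Type) (_ : Fintype ι) (I : ι → Bar),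
      B = Finset.univ.val.map I ∧ DecomposesAs M I := by
  constructor
  · rintro ⟨n, I, rfl, ⟨φ⟩⟩
    exact ⟨Fin n, inferInstance, I, rfl, decomposesAs_of_iso φ⟩
  · rintro ⟨ι, _, I, rfl, h⟩
    let g := (Fintype.equivFin ι).symm
    refine ⟨Fintype.card ι, I ∘ g, ?_, (h.reindex g).nonempty_iso⟩
    rw [← Multiset.map_map, Multiset.map_univ_val_equiv]

lemma exists_barcode_eq {ι : Type} [Fintype ι] {M : PersistenceModule F} {I : ι → Bar}
    (h : DecomposesAs M I) : ∃ (κ : Type) (_ : Fintype κ) (J : κ → Bar),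
      barcode M = Finset.univ.val.map J ∧ DecomposesAs M J := by
  have hB : ∃ B, IsBarcode M B := ⟨_, isBarcode_iff.2 ⟨ι, inferInstance, I, rfl, h⟩⟩
  rw [barcode, dif_pos hB]
  exact isBarcode_iff.1 hB.choose_spec

/-! ### The sum of the largest lengths is an amplitude -/

lemma countP_map_univ {ι α : Type*} [Fintype ι] (f : ι → α) (P : α → Prop) [DecidablePred P] :
    (Finset.univ.val.map f).countP P = (Finset.univ.filter fun i => P (f i)).card := by
  rw [Multiset.countP_map]
  rfl

-- Length > ε implies span ε, but span ε only implies length ≥ ε. As only finitely many lengths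
-- exceed ε, some δ > ε lies strictly below all of these, and comparing spans at δ closes the gap.
open Classical in
lemma topSum_length_le {ι κ : Type} [Fintype ι] [Fintype κ] {I : ι → Bar} {J : κ → Bar}
    (h : ∀ ε : ℝ, 0 ≤ ε → (Finset.univ.filter fun i => (I i).HasSpan ε).card ≤
      (Finset.univ.filter fun j => (J j).HasSpan ε).card) (k : ℕ) :
    topSum k (Finset.univ.val.map fun i => (I i).length) ≤
      topSum k (Finset.univ.val.map fun j => (J j).length) := by
  refine topSum_le_topSum (fun ε _ => ?_) k
  rw [countP_map_univ, countP_map_univ]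
  rcases (Finset.univ.filter fun i => ε < (I i).length).eq_empty_or_nonempty with h0 | h0
  · rw [h0]
    exact Nat.zero_le _
  · obtain ⟨i₀, hi₀, hmin⟩ := Finset.exists_min_image _ (fun i => (I i).length) h0
    obtain ⟨δ, hδ, hδ'⟩ := ENNReal.lt_iff_exists_nnreal_btwn.1 (Finset.mem_filter.1 hi₀).2
    calc _ ≤ (Finset.univ.filter fun i => (I i).HasSpan δ).card := Finset.card_le_card fun i hi =>
          Finset.mem_filter.2 ⟨Finset.mem_univ _,
            Bar.hasSpan_of_lt_length (hδ'.trans_le (hmin i hi))⟩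
      _ ≤ (Finset.univ.filter fun j => (J j).HasSpan δ).card := h δ δ.2
      _ ≤ _ := Finset.card_le_card fun j hj => Finset.mem_filter.2 ⟨Finset.mem_univ _,
            hδ.trans_le (Bar.le_length_of_hasSpan (Finset.mem_filter.1 hj).2)⟩

/-- The identity is injective, so the comparison of spans applies in both directions between the
chosen barcode and any other decomposition. -/
lemma DecomposesAs.tropLen_eq {ι : Type} [Fintype ι] {M : PersistenceModule F} {I : ι → Bar}
    (h : DecomposesAs M I) (k : ℕ) :
    tropLen k M = topSum k (Finset.univ.val.map fun i => (I i).length) := by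
  obtain ⟨κ, _, J, hJ, hMJ⟩ := exists_barcode_eq h
  rw [tropLen, hJ, Multiset.map_map]
  exact le_antisymm
    (topSum_length_le (fun ε hε => card_hasSpan_le_of_injective hMJ h (𝟙 M)
      (fun _ => Function.injective_id) hε) k)
    (topSum_length_le (fun ε hε => card_hasSpan_le_of_injective h hMJ (𝟙 M)
      (fun _ => Function.injective_id) hε) k)

lemma tropLen_le_of_injective {A B : PersistenceModule F} (hA : FinitelyEncoded F A)
    (hB : FinitelyEncoded F B) (f : A ⟶ B) (hf : ∀ t, Function.Injective (f.app t).hom)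
    (k : ℕ) : tropLen k A ≤ tropLen k B := by
  obtain ⟨ι, _, I, hI⟩ := hA.exists_decomposesAs
  obtain ⟨κ, _, J, hJ⟩ := hB.exists_decomposesAs
  rw [hI.tropLen_eq, hJ.tropLen_eq]
  exact topSum_length_le (fun ε hε => card_hasSpan_le_of_injective hI hJ f hf hε) k

lemma tropLen_le_of_surjective {B C : PersistenceModule F} (hB : FinitelyEncoded F B)
    (hC : FinitelyEncoded F C) (g : B ⟶ C) (hg : ∀ t, Function.Surjective (g.app t).hom)
    (k : ℕ) : tropLen k C ≤ tropLen k B := by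
  obtain ⟨ι, _, I, hI⟩ := hC.exists_decomposesAs
  obtain ⟨κ, _, J, hJ⟩ := hB.exists_decomposesAs
  rw [hI.tropLen_eq, hJ.tropLen_eq]
  exact topSum_length_le (fun ε hε => card_hasSpan_le_of_surjective hI hJ g hg hε) k

lemma tropLen_of_isZero {Z : PersistenceModule F} (hZ : IsZero Z) (k : ℕ) : tropLen k Z = 0 := by
  have h : DecomposesAs Z (Empty.elim : Empty → Bar) :=
    ⟨fun i => i.elim, fun i => i.elim, fun i => i.elim, fun i => i.elim, hZ.eq_of_src _ _⟩
  rw [h.tropLen_eq, topSum_eq_sum (by simp)]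
  simp

/-! ### Total length as the integral of the dimension -/

lemma DecomposesAs.finrank_eq {ι : Type} [Fintype ι] {M : PersistenceModule F} {I : ι → Bar}
    (h : DecomposesAs M I) (t : ℝ) : (Module.finrank F (M.obj t) : ℝ≥0∞) =
      ∑ i, (I i).carrier.indicator (fun _ => (1 : ℝ≥0∞)) t := by
  classical
  have h1 := h.rank_eq (le_refl t)
  rw [rank, structureMap_self, LinearMap.range_id, finrank_top] at h1
  simp [h1, Set.indicator_apply]

lemma DecomposesAs.sum_length_eq {ι : Type} [Fintype ι] {M : PersistenceModule F} {I : ι → Bar}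
    (h : DecomposesAs M I) :
    ∑ i, (I i).length = ∫⁻ t, (Module.finrank F (M.obj t) : ℝ≥0∞) := by
  simp only [h.finrank_eq]
  rw [MeasureTheory.lintegral_finsetSum]
  · refine Finset.sum_congr rfl fun i _ => ?_
    rw [MeasureTheory.lintegral_indicator_const (I i).ordConnected.measurableSet, one_mul,
      Bar.length_eq_volume]
  · exact fun i _ => measurable_const.indicator (I i).ordConnected.measurableSet

lemma DecomposesAs.measurable_finrank {ι : Type} [Fintype ι] {M : PersistenceModule F}
    {I : ι → Bar} (h : DecomposesAs M I) :
    Measurable fun t => (Module.finrank F (M.obj t) : ℝ≥0∞) := by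
  simp only [h.finrank_eq]
  exact Finset.measurable_sum _ fun i _ =>
    measurable_const.indicator (I i).ordConnected.measurableSet

/-- If `A` has at most `k` bars of positive length, its total length is `tropLen k A`. -/
lemma DecomposesAs.sum_length_le_tropLen {ι : Type} [Fintype ι] {A : PersistenceModule F}
    {I : ι → Bar} (hA : DecomposesAs A I) {k : ℕ}
    (hk : (Finset.univ.filter fun i => 0 < (I i).length).card ≤ k) :
    ∑ i, (I i).length ≤ tropLen k A := by
  rw [hA.tropLen_eq]
  exact sum_le_topSum (by rwa [countP_map_univ])

-- Brings the number of bars of positive length within reach of the span comparison at ε = 0.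
open Classical in
lemma card_pos_length_le {ι : Type} [Fintype ι] (I : ι → Bar) :
    (Finset.univ.filter fun i => 0 < (I i).length).card ≤
      (Finset.univ.filter fun i => (I i).HasSpan 0).card :=
  Finset.card_le_card fun i hi => Finset.mem_filter.2 ⟨Finset.mem_univ _,
    Bar.hasSpan_of_lt_length (ε := 0) (by simpa using hi)⟩

lemma app_injective_of_mono {M N : PersistenceModule F} (f : M ⟶ N) [Mono f] (t : ℝ) :
    Function.Injective (f.app t).hom :=
  (ModuleCat.mono_iff_injective (f.app t)).1 inferInstance

lemma app_surjective_of_epi {M N : PersistenceModule F} (f : M ⟶ N) [Epi f] (t : ℝ) :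
    Function.Surjective (f.app t).hom :=
  (ModuleCat.epi_iff_surjective (f.app t)).1 inferInstance

/-- The total length of the `k` longest bars of the middle term is carried by a submodule `D` with
at most `k` bars, and `D` is an extension of a submodule of the right term by a submodule of the
left term. -/
lemma tropLen_subadditive (S : ShortComplex (PersistenceModule F)) (hS : S.ShortExact)
    (h₁ : FinitelyEncoded F S.X₁) (h₂ : FinitelyEncoded F S.X₂) (h₃ : FinitelyEncoded F S.X₃)
    (k : ℕ) : tropLen k S.X₂ ≤ tropLen k S.X₁ + tropLen k S.X₃ := by
  classical
  have := hS.mono_f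
  obtain ⟨ι, _, I, hI⟩ := h₂.exists_decomposesAs
  -- A common encoding passes to the retract `D` of the middle term and to the kernel and image of
  -- `D` → `S.X₃`, so these have decompositions too.
  obtain ⟨e, n, he, hn, hB, hC⟩ := exists_common_encoding h₂ h₃
  obtain ⟨T, hT, hsum⟩ := exists_finset_sum_eq_topSum (fun i => (I i).length) k
  have hlen := hI.tropLen_eq k
  obtain ⟨a, p, h1, h2, -⟩ := hI
  let D : PersistenceModule F := ⨁ fun i : T => intervalModule F (I i)
  have hD : DecomposesAs D fun i : T => I i := decomposesAs_of_iso (Iso.refl _)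
  let j : D ⟶ S.X₂ := biproduct.desc fun i : T => a i
  let q : S.X₂ ⟶ D := biproduct.lift fun i : T => p i
  have hjq : j ≫ q = 𝟙 D := by
    refine biproduct.hom_ext' _ _ fun i => biproduct.hom_ext _ _ fun i' => ?_
    by_cases hii : i = i'
    · subst hii
      simp [j, q, D, h1]
    · simp [j, q, D, h2 _ _ (fun h => hii (Subtype.ext h)), biproduct.ι_π_ne _ hii]
  have hDe : ConstantOnFibers e D := hB.of_retract j q hjq
  have hj : ∀ t, Function.Injective (j.app t).hom := fun t =>
    Function.LeftInverse.injective (g := (q.app t).hom) fun x =>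
      congrArg (fun f => (f.app t).hom x) hjq
  have hKe := hDe.ker hC (j ≫ S.g)
  have hEe := hDe.range hC (j ≫ S.g)
  obtain ⟨κ, _, J, hJ⟩ := hKe.exists_decomposesAs he hn
  obtain ⟨μ, _, L, hL⟩ := hEe.exists_decomposesAs he hn
  let incl := subModuleIncl D (fun t => LinearMap.ker ((j ≫ S.g).app t).hom) fun s t h x hx => by
    rw [LinearMap.mem_ker, app_structureMap, LinearMap.mem_ker.1 hx, map_zero]
  have hincl : ∀ t, Function.Injective (incl.app t).hom := subModuleIncl_injective _ _ _
  have hinclg : (incl ≫ j) ≫ S.g = 0 := hom_ext_apply fun t x => x.2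
  let toX₁ := hS.exact.lift (incl ≫ j) hinclg
  have htoX₁ : ∀ t, Function.Injective (toX₁.app t).hom := fun t => by
    refine Function.Injective.of_comp (f := (S.f.app t).hom) ?_
    have h : ∀ x, (S.f.app t).hom ((toX₁.app t).hom x) = (j.app t).hom ((incl.app t).hom x) :=
      fun x => congrArg (fun f => (f.app t).hom x) (hS.exact.lift_f (incl ≫ j) hinclg)
    exact fun x y hxy => hincl t (hj t ((h x).symm.trans (hxy.trans (h y))))
  let toRange : D ⟶ rangeModule (j ≫ S.g) := subModuleLift _ _ (j ≫ S.g) fun t x => ⟨x, rfl⟩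
  have htoRange : ∀ t, Function.Surjective (toRange.app t).hom := by
    rintro t ⟨_, x, rfl⟩
    exact ⟨x, rfl⟩
  have hcard : (Finset.univ.filter fun i : T => (I i).HasSpan 0).card ≤ k :=
    (Finset.card_le_univ _).trans (by simpa using hT)
  have hK : ∑ i, (J i).length ≤ tropLen k S.X₁ :=
    (hJ.sum_length_le_tropLen ((card_pos_length_le J).trans
      ((card_hasSpan_le_of_injective hJ hD incl hincl le_rfl).trans hcard))).trans
      (tropLen_le_of_injective (finitelyEncoded_of_constantOnFibers hKe he hn) h₁ toX₁ htoX₁ k)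
  have hE : ∑ i, (L i).length ≤ tropLen k S.X₃ :=
    (hL.sum_length_le_tropLen ((card_pos_length_le L).trans
      ((card_hasSpan_le_of_surjective hL hD toRange htoRange le_rfl).trans hcard))).trans
      (tropLen_le_of_injective (finitelyEncoded_of_constantOnFibers hEe he hn) h₃
        (subModuleIncl _ _ _) (subModuleIncl_injective _ _ _) k)
  -- Rank-nullity for `D` → `S.X₃` at each parameter, integrated over the line.
  have hadd : ∑ i : T, (I i).length = ∑ i, (J i).length + ∑ i, (L i).length := by
    rw [hD.sum_length_eq, hJ.sum_length_eq, hL.sum_length_eq,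
      ← MeasureTheory.lintegral_add_left hJ.measurable_finrank]
    refine MeasureTheory.lintegral_congr fun t => ?_
    have := hDe.finiteDimensional t
    have h := LinearMap.finrank_range_add_finrank_ker ((j ≫ S.g).app t).hom
    rw [add_comm] at h
    exact_mod_cast h.symm
  calc tropLen k S.X₂ = ∑ i : T, (I i).length := by
        rw [hlen, ← hsum, ← Finset.sum_coe_sort]
    _ ≤ _ := hadd ▸ add_le_add hK hE

lemma isAmplitude_tropLen (F : Type u) [Field F] (k : ℕ) :
    IsAmplitude (FinitelyEncoded F) (fun M => ((tropLen k M : ℝ≥0∞) : EReal)) where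
  nonneg _ _ := EReal.coe_ennreal_nonneg _
  zero Z _ hZ := by rw [tropLen_of_isZero hZ, EReal.coe_ennreal_zero]
  mono_left S hS h₁ h₂ _ := by
    have := hS.mono_f
    exact EReal.coe_ennreal_le_coe_ennreal_iff.2
      (tropLen_le_of_injective h₁ h₂ S.f (app_injective_of_mono S.f) k)
  mono_right S hS _ h₂ h₃ := by
    have := hS.epi_g
    exact EReal.coe_ennreal_le_coe_ennreal_iff.2
      (tropLen_le_of_surjective h₂ h₃ S.g (app_surjective_of_epi S.g) k)
  subadd S hS h₁ h₂ h₃ := by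
    rw [← EReal.coe_ennreal_add]
    exact EReal.coe_ennreal_le_coe_ennreal_iff.2 (tropLen_subadditive S hS h₁ h₂ h₃ k)

/-! ### The tropical coordinates involving births -/

lemma Bar.ext_carrier {I J : Bar} (h : I.carrier = J.carrier) : I = J := by
  cases I
  cases J
  congr

/-- The barcode of an interval module. -/
lemma barcode_intervalModule (I : Bar) : barcode (intervalModule F I) = {I} := by
  classical
  obtain ⟨κ, _, J, hJ, hMJ⟩ := exists_barcode_eq (decomposesAs_intervalModule (F := F) I)
  -- The ranks determine the bars: exactly one bar passes over each point of `I`, and any two points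
  -- of `I` share a bar, so one bar is all of `I`. Any other bar, being nonempty, would meet it.
  have key : ∀ s t, s ≤ t →
      (Finset.univ.filter fun j => s ∈ (J j).carrier ∧ t ∈ (J j).carrier).card =
        if s ∈ I.carrier ∧ t ∈ I.carrier then 1 else 0 := fun s t hst => by
    rw [← hMJ.rank_eq hst, (decomposesAs_intervalModule I).rank_eq hst]
    split_ifs with h <;> simp [h]
  have hsub : ∀ j t, t ∈ (J j).carrier → t ∈ I.carrier := fun j t ht => by
    by_contra hI
    have h := key t t le_rfl
    rw [if_neg (fun h => hI h.1), Finset.card_eq_zero] at h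
    exact Finset.notMem_empty j (h ▸ Finset.mem_filter.2 ⟨Finset.mem_univ j, ht, ht⟩)
  have huniq : ∀ j j' t, t ∈ (J j).carrier → t ∈ (J j').carrier → j = j' := fun j j' t h h' => by
    have hc := key t t le_rfl
    rw [if_pos ⟨hsub j t h, hsub j t h⟩] at hc
    exact Finset.card_le_one.1 hc.le j (Finset.mem_filter.2 ⟨Finset.mem_univ _, h, h⟩) j'
      (Finset.mem_filter.2 ⟨Finset.mem_univ _, h', h'⟩)
  have hex' : ∀ s t, s ≤ t → s ∈ I.carrier → t ∈ I.carrier →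
      ∃ j, s ∈ (J j).carrier ∧ t ∈ (J j).carrier := fun s t hst hs ht => by
    have hc := key s t hst
    rw [if_pos ⟨hs, ht⟩] at hc
    obtain ⟨j, hj⟩ := Finset.card_pos.1 (hc ▸ Nat.one_pos)
    exact ⟨j, (Finset.mem_filter.1 hj).2⟩
  have hex : ∀ s t, s ∈ I.carrier → t ∈ I.carrier →
      ∃ j, s ∈ (J j).carrier ∧ t ∈ (J j).carrier := fun s t hs ht => by
    rcases le_total s t with h | h
    · exact hex' s t h hs ht
    · exact (hex' t s h ht hs).imp fun j hj => hj.symm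
  obtain ⟨t₀, ht₀⟩ := I.nonempty
  obtain ⟨j₀, hj₀, -⟩ := hex t₀ t₀ ht₀ ht₀
  have hJ₀ : J j₀ = I := Bar.ext_carrier <| Set.Subset.antisymm (hsub j₀) fun t ht => by
    obtain ⟨j, h, h'⟩ := hex t₀ t ht₀ ht
    rwa [huniq j₀ j t₀ hj₀ h]
  have huniv : (Finset.univ : Finset κ) = {j₀} := by
    refine Finset.eq_singleton_iff_unique_mem.2 ⟨Finset.mem_univ _, fun j _ => ?_⟩
    obtain ⟨t, ht⟩ := (J j).nonempty
    exact huniq j j₀ t ht (hJ₀ ▸ hsub j t ht)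
  rw [hJ, huniv, Finset.singleton_val, Multiset.map_singleton, hJ₀]

lemma topSum_singleton {R : Type*} [LinearOrder R] [AddCommMonoid R] {l : ℕ} (hl : 1 ≤ l)
    (x : R) : topSum l {x} = x := by
  rw [topSum, Multiset.sort_singleton, List.take_of_length_le (by simpa using hl),
    List.sum_singleton]

lemma tropBirth_intervalModule (I : Bar) (m : ℕ) {l : ℕ} (hl : 1 ≤ l) :
    tropBirth m l (intervalModule F I) = min I.birth ((m : EReal) * (I.length : EReal)) := by
  rw [tropBirth, barcode_intervalModule, Multiset.map_singleton, topSum_singleton hl]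

/-! ### Half-open intervals and their short exact sequences -/

/-- The half-open interval `[a, b)`. -/
def icoBar (a b : ℝ) (h : a < b) : Bar where
  carrier := Set.Ico a b
  ordConnected := Set.ordConnected_Ico
  nonempty := Set.nonempty_Ico.2 h

lemma mem_icoBar {a b : ℝ} (h : a < b) (t : ℝ) : t ∈ (icoBar a b h).carrier ↔ a ≤ t ∧ t < b :=
  Iff.rfl

lemma birth_icoBar {a b : ℝ} (h : a < b) : (icoBar a b h).birth = a :=
  le_antisymm (sInf_le ⟨a, ⟨le_rfl, h⟩, rfl⟩)
    (le_sInf fun _ ⟨_, ht, hx⟩ => hx ▸ EReal.coe_le_coe_iff.2 ht.1)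

lemma length_icoBar {a b : ℝ} (h : a < b) : (icoBar a b h).length = ENNReal.ofReal (b - a) := by
  rw [Bar.length_eq_volume]
  exact Real.volume_Ico

lemma finitelyEncoded_icoBar (F : Type u) [Field F] {a b : ℝ} (h : a < b) :
    FinitelyEncoded F (intervalModule F (icoBar a b h)) := by
  let e : ℝ → ℕ := fun t => if t < a then 0 else if t < b then 1 else 2
  have he : Monotone e := fun s t hst => by
    simp only [e]
    split_ifs <;> first | omega | (exfalso; linarith)
  have hn : ∀ t, e t < 3 := fun t => by
    simp only [e]
    split_ifs <;> omega
  refine finitelyEncoded_of_constantOnFibers (e := e)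
    (constantOnFibers_intervalModule fun s t hst hst' => ?_) he hn
  have key : ∀ t, t ∈ (icoBar a b h).carrier ↔ e t = 1 := fun t => by
    rw [mem_icoBar]
    simp only [e]
    split_ifs with h1 h2
    · simpa using fun h3 : a ≤ t => absurd h1 (not_lt.2 h3)
    · simpa using ⟨not_lt.1 h1, h2⟩
    · simpa using fun _ => not_lt.1 h2
  rw [key, key, hst']

lemma finitelyEncodedNonneg_icoBar (F : Type u) [Field F] {a b : ℝ} (h : a < b) (ha : 0 ≤ a) :
    FinitelyEncodedNonneg F (intervalModule F (icoBar a b h)) := by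
  refine ⟨finitelyEncoded_icoBar F h, fun t ht => ?_⟩
  have : Subsingleton ((intervalModule F (icoBar a b h)).obj t) := ⟨fun x y => by
    have hmem : t ∉ (icoBar a b h).carrier := fun h' => absurd (ha.trans h'.1) (not_le.2 ht)
    exact intervalCoord_injective _ t
      ((intervalCoord_eq_zero hmem x).trans (intervalCoord_eq_zero hmem y).symm)⟩
  exact ModuleCat.isZero_of_subsingleton _

open Classical in
/-- The morphism of interval modules that is the identity of `F` on the intersection of the bars. -/
def intervalHom (F : Type u) [Field F] (I J : Bar) (h : ∀ s t, s ≤ t → s ∈ I.carrier →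
    t ∈ J.carrier → s ∈ J.carrier ∧ t ∈ I.carrier) :
    intervalModule F I ⟶ intervalModule F J :=
  homMk (fun t => if ht : t ∈ J.carrier then intervalLift ht (intervalCoord I t) else 0) <| by
    intro s t hst x
    refine intervalCoord_injective J t ?_
    by_cases ht : t ∈ J.carrier
    · rw [intervalCoord_structureMap hst ht, dif_pos ht, intervalCoord_intervalLift]
      by_cases hs : s ∈ I.carrier
      · obtain ⟨hs', ht'⟩ := h s t hst hs ht
        rw [dif_pos hs', intervalCoord_intervalLift, intervalCoord_structureMap hst ht']
      · have hx : x = 0 := intervalCoord_injective I s (by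
          rw [intervalCoord_eq_zero hs, map_zero])
        rw [hx]
        simp only [map_zero]
    · rw [intervalCoord_eq_zero ht, intervalCoord_eq_zero ht]

lemma intervalCoord_intervalHom {I J : Bar} (h) {t : ℝ} (ht : t ∈ J.carrier)
    (x : (intervalModule F I).obj t) :
    intervalCoord J t (((intervalHom F I J h).app t).hom x) = intervalCoord I t x :=
  congrArg (intervalCoord J t) (LinearMap.congr_fun (dif_pos ht) x)

/-- Evaluation at a parameter commutes with homology, so exactness can be tested pointwise. -/
lemma shortExact_of_forall {S : ShortComplex (PersistenceModule F)}
    (hf : ∀ t, Function.Injective (S.f.app t).hom)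
    (hg : ∀ t, Function.Surjective (S.g.app t).hom)
    (hfg : ∀ t x, (S.g.app t).hom x = 0 → ∃ y, (S.f.app t).hom y = x) : S.ShortExact where
  exact := by
    rw [ShortComplex.exact_iff_isZero_homology, Functor.isZero_iff]
    intro t
    refine IsZero.of_iso ?_ (S.mapHomologyIso ((evaluation ℝ (ModuleCat.{u} F)).obj t)).symm
    rw [← ShortComplex.exact_iff_isZero_homology, ShortComplex.moduleCat_exact_iff]
    exact hfg t
  mono_f := by
    have : ∀ t, Mono (S.f.app t) := fun t => (ModuleCat.mono_iff_injective _).2 (hf t)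
    exact NatTrans.mono_of_mono_app _
  epi_g := by
    have : ∀ t, Epi (S.g.app t) := fun t => (ModuleCat.epi_iff_surjective _).2 (hg t)
    exact NatTrans.epi_of_epi_app _

/-- For `a < b < c` there is a short exact sequence of the interval modules of `[b, c)`, `[a, c)`
and `[a, b)`. -/
lemma exists_shortExact_icoBar (F : Type u) [Field F] {a b c : ℝ} (hab : a < b) (hbc : b < c) :
    ∃ (f : intervalModule F (icoBar b c hbc) ⟶ intervalModule F (icoBar a c (hab.trans hbc)))
      (g : intervalModule F (icoBar a c (hab.trans hbc)) ⟶ intervalModule F (icoBar a b hab))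
      (w : f ≫ g = 0), (ShortComplex.mk f g w).ShortExact := by
  let f := intervalHom F (icoBar b c hbc) (icoBar a c (hab.trans hbc)) fun s t hst hs ht =>
    ⟨⟨hab.le.trans hs.1, hs.2⟩, ⟨hs.1.trans hst, ht.2⟩⟩
  let g := intervalHom F (icoBar a c (hab.trans hbc)) (icoBar a b hab) fun s t hst hs ht =>
    ⟨⟨hs.1, hst.trans_lt ht.2⟩, ⟨ht.1, ht.2.trans hbc⟩⟩
  have hf : ∀ t, t ∈ (icoBar a c (hab.trans hbc)).carrier → ∀ x,
      intervalCoord _ t ((f.app t).hom x) = intervalCoord _ t x := fun t ht x =>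
    intervalCoord_intervalHom _ ht x
  have hg : ∀ t, t ∈ (icoBar a b hab).carrier → ∀ x,
      intervalCoord _ t ((g.app t).hom x) = intervalCoord _ t x := fun t ht x =>
    intervalCoord_intervalHom _ ht x
  have hsub : ∀ t, t ∈ (icoBar b c hbc).carrier → t ∈ (icoBar a c (hab.trans hbc)).carrier :=
    fun t ht => ⟨hab.le.trans ht.1, ht.2⟩
  have hsub' : ∀ t, t ∈ (icoBar a b hab).carrier → t ∈ (icoBar a c (hab.trans hbc)).carrier :=
    fun t ht => ⟨ht.1, ht.2.trans hbc⟩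
  refine ⟨f, g, hom_ext_apply fun t x => intervalCoord_injective _ t ?_,
    shortExact_of_forall (fun t x y hxy => intervalCoord_injective _ t ?_) (fun t y => ?_)
      fun t x hx => ?_⟩
  · change intervalCoord _ t ((g.app t).hom ((f.app t).hom x)) = intervalCoord _ t 0
    rw [map_zero]
    by_cases ht : t ∈ (icoBar a b hab).carrier
    · rw [hg t ht, hf t (hsub' t ht),
        intervalCoord_eq_zero fun h : t ∈ (icoBar b c hbc).carrier => absurd h.1 (not_le.2 ht.2)]
    · exact intervalCoord_eq_zero ht _
  · by_cases ht : t ∈ (icoBar b c hbc).carrier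
    · rw [← hf t (hsub t ht), ← hf t (hsub t ht)]
      exact congrArg _ hxy
    · rw [intervalCoord_eq_zero ht, intervalCoord_eq_zero ht]
  · by_cases ht : t ∈ (icoBar a b hab).carrier
    · obtain ⟨x, hx⟩ := exists_intervalCoord_eq (I := icoBar a c (hab.trans hbc)) (t := t)
        (c := intervalCoord _ t y) fun h => absurd (hsub' t ht) h
      exact ⟨x, intervalCoord_injective _ t ((hg t ht x).trans hx)⟩
    · exact ⟨0, intervalCoord_injective _ t
        ((intervalCoord_eq_zero ht _).trans (intervalCoord_eq_zero ht _).symm)⟩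
  -- A kernel vector lifts because its coordinate vanishes off [b, c): on [a, b) the map `g`
  -- preserves the coordinate, and outside [a, c) the space is zero.
  · obtain ⟨y, hy⟩ := exists_intervalCoord_eq (I := icoBar b c hbc) (t := t)
      (c := intervalCoord _ t x) fun h => by
        by_cases ht : t ∈ (icoBar a c (hab.trans hbc)).carrier
        · rw [← hg t ⟨ht.1, not_le.1 fun hbt => h ⟨hbt, ht.2⟩⟩]
          exact (congrArg _ hx).trans (map_zero _)
        · exact intervalCoord_eq_zero ht _
    refine ⟨y, intervalCoord_injective _ t ?_⟩
    by_cases ht : t ∈ (icoBar a c (hab.trans hbc)).carrier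
    · exact (hf t ht y).trans hy
    · exact (intervalCoord_eq_zero ht _).trans (intervalCoord_eq_zero ht _).symm

/-- The interval module of `[-1, 0)` has a negative value. -/
lemma not_isAmplitude_tropBirth (F : Type u) [Field F] (m : ℕ) {l : ℕ} (hl : 1 ≤ l) :
    ¬ IsAmplitude (FinitelyEncoded F) (fun M => tropBirth m l M) := by
  intro h
  have h1 := h.nonneg _ (finitelyEncoded_icoBar F (show (-1 : ℝ) < 0 by norm_num))
  rw [tropBirth_intervalModule _ m hl, birth_icoBar] at h1
  have h2 := h1.trans (min_le_left _ _)
  rw [← EReal.coe_zero, EReal.coe_le_coe_iff] at h2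
  norm_num at h2

/-- The submodule `[1, 2)` of the interval module of `[0, 2)` has a larger value. -/
lemma not_isAmplitude_tropBirth_nonneg (F : Type u) [Field F] {m l : ℕ} (hm : 1 ≤ m)
    (hl : 1 ≤ l) : ¬ IsAmplitude (FinitelyEncodedNonneg F) (fun M => tropBirth m l M) := by
  intro h
  obtain ⟨f, g, w, hS⟩ := exists_shortExact_icoBar F (a := 0) (b := 1) (c := 2)
    (by norm_num) (by norm_num)
  have h1 := h.mono_left _ hS (finitelyEncodedNonneg_icoBar F _ zero_le_one)
    (finitelyEncodedNonneg_icoBar F _ le_rfl) (finitelyEncodedNonneg_icoBar F _ le_rfl)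
  simp only [tropBirth_intervalModule _ m hl, birth_icoBar, length_icoBar] at h1
  have h2 := h1.trans (min_le_left _ _)
  -- The submodule has birth 1 and length 1, so its value min(1, m) is positive exactly because m ≥
  -- 1.
  refine absurd h2 (not_le.2 (lt_min ?_ ?_))
  · exact EReal.coe_lt_coe_iff.2 one_pos
  · have h3 : ENNReal.ofReal (2 - 1) = 1 := by norm_num
    rw [h3, EReal.coe_ennreal_one, mul_one, EReal.coe_zero]
    exact_mod_cast hm

end PersMod

end

theorem propositionP (F : Type u) [Field F] :
    (∀ k : ℕ, PersMod.IsAmplitude (PersMod.FinitelyEncoded F)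
      (fun M => ((PersMod.tropLen k M : ℝ≥0∞) : EReal))) ∧
    (∀ m l : ℕ, 1 ≤ l → ¬ PersMod.IsAmplitude (PersMod.FinitelyEncoded F)
      (fun M => PersMod.tropBirth m l M)) ∧
    (∀ m l : ℕ, 1 ≤ m → 1 ≤ l → ¬ PersMod.IsAmplitude (PersMod.FinitelyEncodedNonneg F)
      (fun M => PersMod.tropBirth m l M)) :=
  ⟨PersMod.isAmplitude_tropLen F, fun m _ hl => PersMod.not_isAmplitude_tropBirth F m hl,
    fun _ _ hm hl => PersMod.not_isAmplitude_tropBirth_nonneg F hm hl⟩
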